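/- **Definitions.** Fix the standard computable presentation of the algebraic complex numbers, in which an algebraic number is coded by a nonzero integer polynomial together with a disc (with dyadic rational centre and radius) in which it is the only root of that polynomial; computability of sequences of algebraic numbers, vectors or matrices refers to these codes. A *state* is a sequence $\rho=(\rho_n)_{n\in\mathbb N}$ of density matrices $\rho_n\in\mathbb C^{2^n\times 2^n}$ such that, for every $n$, tracing out the last qubit of $\rho_{n+1}$ gives $\rho_n$. A *special projection* is a Hermitian projection matrix with algebraic entries. A *quantum $\Sigma^0_1$ class* is a computable sequence $G=(p_n)_{n\in\mathbb N}$ of special projections, $p_n$ of size $2^n\times 2^n$, with $\operatorname{range}(p_n\otimes I)\subseteq\operatorname{range}(p_{n+1})$ for all $n$, where $I$ is the $2\times2$ identity; put $\tau(G)=\lim_n 2^{-n}\operatorname{rank}(p_n)$ and $\rho(G)=\lim_n\operatorname{tr}(\rho_np_n)$. A *quantum Martin-Löf test* is a (uniformly) computable sequence $(S_m)_{m\in\mathbb N}$ of quantum $\Sigma^0_1$ classes with $\tau(S_m)\le 2^{-m}$ for all $m$. The state $\rho$ is *quantum Martin-Löf random* (q-MLR) if $\inf_m\rho(S_m)=0$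 for every quantum Martin-Löf test $(S_m)_m$. A *$\Sigma^0_1$ class* is a set $\bigcup_i[\![A_i]\!]\subseteq 2^\omega$, where $(A_i)_i$ is a computable sequence of finite sets $A_i\subseteq 2^i$, $[\![A_i]\!]$ is the set of infinite bit sequences whose first $i$ bits form a string in $A_i$, and $[\![A_i]\!]\subseteq[\![A_{i+1}]\!]$. A *Martin-Löf test* is a (uniformly) computable sequence $(S_m)_m$ of $\Sigma^0_1$ classes whose uniform measure is at most $2^{-m}$, and $\mathrm{MLR}\subseteq2^\omega$ is the set of sequences that lie in $\bigcap_mS_m$ for no Martin-Löf test $(S_m)_m$. A *computable measurement system* is a computable sequence $B=((b^n_0,b^n_1))_{n\ge1}$ of orthonormal bases of $\mathbb C^2$ consisting of vectors with algebraic entries. For a state $\rho$, let $\mu^B_\rho$ be the unique probability measure on $2^\omega$ such that, for every $n$ and every $\tau\in2^n$, the set of sequences extending $\tau$ has measure $\operatorname{tr}\big(\rho_n|v_\tau\rangle\langle v_\tau|\big)$ with $v_\tau=\bigotimes_{i=1}^n b^i_{\tau(i)}$; this is the law of the bit sequence obtained by measuring $\rho$ qubit by qubit in $B$. The state $\rho$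 is *measurement random* (mR) if $\mu^B_\rho(\mathrm{MLR})=1$ for every computable measurement system $B$. **Theorem.** Every quantum Martin-Löf random state is measurement random. -/

import Mathlib

noncomputable section

open MeasureTheory Filter Topology Matrix Polynomial
open scoped ComplexOrder Kronecker

/-! ### Cantor space, cylinders and classical Martin-Löf randomness -/

/-- Cantor space: infinite sequences of bits. -/
abbrev Cantor : Type := ℕ → Bool

/-- Bit strings of length `n`. -/
abbrev BitStr (n : ℕ) : Type := Fin n → Bool

/-- The cylinder of a string: all infinite sequences extending it. -/
def cyl {n : ℕ} (τ : BitStr n) : Set Cantor := {X | ∀ i : Fin n, X i = τ i}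

/-- `⟦C⟧` for a set `C` of strings of length `n`: all sequences whose initial segment of length `n`
is in `C`. -/
def cylSet {n : ℕ} (C : Finset (BitStr n)) : Set Cantor := {X | (fun i : Fin n => X i) ∈ C}

/-- The uniform measure on Cantor space: the law of independent fair coin flips. -/
def uniformMeasure : Measure Cantor :=
  Measure.infinitePi fun _ : ℕ => (PMF.uniformOfFintype Bool).toMeasure

/-- The list `l` of finite strings codes the finite set `C` of strings of length `n`. -/
def CodesSet (l : List (List Bool)) {n : ℕ} (C : Finset (BitStr n)) : Prop :=
  ∀ s : List Bool, s ∈ l ↔ ∃ τ ∈ C, List.ofFn τ = s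

/-- A computable sequence of `Σ⁰₁` classes: `S m = ⋃ i, ⟦A m i⟧` where `A m i` is a finite set of
strings of length `i`, `⟦A m i⟧` increases with `i`, and (a code of) `A m i` is computable from
`m` and `i`. -/
def IsComputableSigmaSeq (S : ℕ → Set Cantor) : Prop :=
  ∃ A : ∀ _ i : ℕ, Finset (BitStr i),
    (∃ L : ℕ → ℕ → List (List Bool), Computable₂ L ∧ ∀ m i, CodesSet (L m i) (A m i)) ∧
    (∀ m i, cylSet (A m i) ⊆ cylSet (A m (i + 1))) ∧
    ∀ m, S m = ⋃ i, cylSet (A m i)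

/-- A (classical) Martin-Löf test. -/
def IsMLTest (S : ℕ → Set Cantor) : Prop :=
  IsComputableSigmaSeq S ∧ ∀ m, uniformMeasure (S m) ≤ (2 : ENNReal)⁻¹ ^ m

/-- The set of Martin-Löf random sequences: those that lie in no effectively null set
`⋂ m, S m`, with `S` a Martin-Löf test. -/
def MLR : Set Cantor := {X | ∀ S : ℕ → Set Cantor, IsMLTest S → X ∉ ⋂ m, S m}

/-! ### The computable presentation of the algebraic complex numbers -/

/-- The integer polynomial with the given list of coefficients (constant coefficient first). -/
def polyOfList (l : List ℤ) : ℤ[X] := l.foldr (fun a q => C a + X * q) 0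

/-- A code `(l, a, b, k)`: an integer polynomial `l` and the open disc with centre
`(a + b i) / 2 ^ k` and radius `1 / 2 ^ k`. -/
abbrev AlgCode : Type := List ℤ × ℤ × ℤ × ℕ

/-- A code names the complex number `α` if its polynomial is nonzero and `α` is the one and only
root of the polynomial in the disc of the code. -/
def AlgCode.Names (c : AlgCode) (α : ℂ) : Prop :=
  polyOfList c.1 ≠ 0 ∧
  ∀ z : ℂ, (aeval z (polyOfList c.1) = 0 ∧
    ‖z - ((c.2.1 : ℂ) + (c.2.2.1 : ℂ) * Complex.I) / 2 ^ c.2.2.2‖ < 1 / 2 ^ c.2.2.2) ↔ z = α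

/-! ### Matrices on `n` qubits and states -/

/-- Complex `2 ^ n` by `2 ^ n` matrices; the standard basis of `(ℂ²)^{⊗ n}` is indexed by bit
strings of length `n`. -/
abbrev QubitMatrix (n : ℕ) : Type := Matrix (BitStr n) (BitStr n) ℂ

/-- Append one bit to a string. -/
def snocBit {n : ℕ} (x : BitStr n) (b : Bool) : BitStr (n + 1) :=
  Fin.snoc (α := fun _ => Bool) x b

/-- The partial trace that traces out the last qubit. -/
def partialTrace {n : ℕ} (M : QubitMatrix (n + 1)) : QubitMatrix n :=
  fun x y => ∑ b : Bool, M (snocBit x b) (snocBit y b)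

/-- `M ⊗ I` with `I` the identity on the last, new, qubit. -/
def tensorOne {n : ℕ} (M : QubitMatrix n) : QubitMatrix (n + 1) :=
  (M ⊗ₖ (1 : Matrix Bool Bool ℂ)).submatrix
    (fun x => (fun i : Fin n => x i.castSucc, x (Fin.last n)))
    (fun x => (fun i : Fin n => x i.castSucc, x (Fin.last n)))

/-- A state: a coherent sequence of density matrices, the `n`-th one on `n` qubits. -/
structure QState where
  /-- The density matrix of the first `n` qubits. -/
  mat : ∀ n : ℕ, QubitMatrix n
  posSemidef : ∀ n, (mat n).PosSemidef
  trace_eq_one : ∀ n, (mat n).trace = 1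
  coherent : ∀ n, partialTrace (mat (n + 1)) = mat n

/-! ### Quantum Martin-Löf randomness -/

/-- A special projection: a Hermitian projection matrix with complex algebraic entries. -/
def IsSpecialProjection {n : ℕ} (p : QubitMatrix n) : Prop :=
  p.IsHermitian ∧ p * p = p ∧ ∀ x y, IsAlgebraic ℚ (p x y)

/-- A family of matrices with algebraic entries, indexed by `a : ι`, where `P a` acts on `d a`
qubits, is computable if codes of the entries of `P a` are computable from `a`. -/
def ComputableMatrices {ι : Type} [Primcodable ι] (d : ι → ℕ) (P : ∀ a, QubitMatrix (d a)) : Prop :=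
  ∃ f : ι × List Bool × List Bool → AlgCode, Computable f ∧
    ∀ a (x y : BitStr (d a)), (f (a, List.ofFn x, List.ofFn y)).Names (P a x y)

/-- A quantum `Σ⁰₁` class. -/
def IsQSigma (G : ∀ n, QubitMatrix n) : Prop :=
  ComputableMatrices (fun n : ℕ => n) G ∧
  (∀ n, IsSpecialProjection (G n)) ∧
  ∀ n, LinearMap.range (tensorOne (G n)).mulVecLin ≤ LinearMap.range (G (n + 1)).mulVecLin

/-- `τ(G) = lim 2^{-n} rank (G n)`; the sequence is nondecreasing and bounded by `1` when `G` is a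
quantum `Σ⁰₁` class. -/
def qTau (G : ∀ n, QubitMatrix n) : ℝ :=
  limUnder atTop fun n : ℕ => ((G n).rank : ℝ) / 2 ^ n

/-- `ρ(G) = lim tr (ρ_n G_n)`; the sequence is nondecreasing and bounded by `1` when `G` is a
quantum `Σ⁰₁` class. -/
def QState.eval (ρ : QState) (G : ∀ n, QubitMatrix n) : ℝ :=
  limUnder atTop fun n : ℕ => (ρ.mat n * G n).trace.re

/-- A quantum Martin-Löf test: a (uniformly) computable sequence of quantum `Σ⁰₁` classes with
`τ(S m) ≤ 2^{-m}`. -/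
def IsQMLTest (S : ℕ → ∀ n, QubitMatrix n) : Prop :=
  (∀ m, IsQSigma (S m)) ∧
  ComputableMatrices (fun a : ℕ × ℕ => a.2) (fun a => S a.1 a.2) ∧
  ∀ m, qTau (S m) ≤ (2 : ℝ)⁻¹ ^ m

/-- A state is quantum Martin-Löf random if no quantum Martin-Löf test detects it. -/
def QState.IsQMLR (ρ : QState) : Prop :=
  ∀ S : ℕ → ∀ n, QubitMatrix n, IsQMLTest S → ⨅ m, ρ.eval (S m) = 0

/-! ### Measuring a state qubit by qubit -/

/-- A sequence of orthonormal bases of `ℂ²`, one for each qubit. -/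
abbrev MeasurementSystem : Type := ℕ → OrthonormalBasis Bool ℂ (EuclideanSpace ℂ Bool)

/-- The system is computable: the vectors have algebraic entries, and codes of them are computable
from the number `n` of the qubit, the label `i` of the vector and the coordinate `j`. -/
def IsComputableSystem (B : MeasurementSystem) : Prop :=
  ∃ f : ℕ × Bool × Bool → AlgCode, Computable f ∧ ∀ n i j, (f (n, i, j)).Names (B n i j)

/-- The product vector `⊗_i b^i_{τ(i)}`. -/
def productVec (B : MeasurementSystem) {n : ℕ} (τ : BitStr n) : BitStr n → ℂ :=
  fun x => ∏ i : Fin n, B i (τ i) (x i)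

/-- The probability `p(τ) = tr (ρ_n |⊗ b^i_{τ(i)}⟩⟨⊗ b^i_{τ(i)}|)` that measuring the first `n`
qubits of `ρ` one after the other in the bases of `B` gives the outcome `τ`. -/
def outcomeProb (ρ : QState) (B : MeasurementSystem) {n : ℕ} (τ : BitStr n) : ℝ :=
  (ρ.mat n * vecMulVec (productVec B τ) (star (productVec B τ))).trace.re

lemma outcomeProb_eq (ρ : QState) (B : MeasurementSystem) {n : ℕ} (τ : BitStr n) :
    outcomeProb ρ B τ
      = (∑ x, ∑ y, ρ.mat n x y * (productVec B τ y * star (productVec B τ x))).re := by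
  simp [outcomeProb, Matrix.trace, Matrix.mul_apply, vecMulVec_apply]

lemma outcomeProb_nonneg (ρ : QState) (B : MeasurementSystem) {n : ℕ} (τ : BitStr n) :
    0 ≤ outcomeProb ρ B τ := by
  have h := (ρ.posSemidef n).dotProduct_mulVec_nonneg (productVec B τ)
  have h2 := (Complex.le_def.1 h).1
  rw [outcomeProb_eq]
  refine h2.trans_eq (congrArg Complex.re ?_)
  simp only [dotProduct, mulVec, Finset.mul_sum]
  refine Finset.sum_congr rfl fun x _ => Finset.sum_congr rfl fun y _ => ?_
  simp only [Pi.star_apply]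
  ring

lemma outcomeProb_zero (ρ : QState) (B : MeasurementSystem) (τ : BitStr 0) :
    outcomeProb ρ B τ = 1 := by
  have h := ρ.trace_eq_one 0
  have h1 : vecMulVec (productVec B τ) (star (productVec B τ)) = 1 := by
    ext x y
    obtain rfl := Subsingleton.elim x y
    simp [vecMulVec_apply, productVec]
  simp [outcomeProb, h1, h]

lemma sum_basis_mul_star (b : OrthonormalBasis Bool ℂ (EuclideanSpace ℂ Bool)) (j k : Bool) :
    ∑ i, b i j * star (b i k) = if j = k then 1 else 0 := by
  have h := b.sum_inner_mul_inner (EuclideanSpace.single j (1 : ℂ)) (EuclideanSpace.single k 1)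
  simpa [EuclideanSpace.inner_single_left, EuclideanSpace.inner_single_right, eq_comm] using h

lemma sum_bitStr_succ {M : Type*} [AddCommMonoid M] {n : ℕ} (f : BitStr (n + 1) → M) :
    ∑ x, f x = ∑ x : BitStr n, ∑ b : Bool, f (snocBit x b) := by
  rw [← (Fin.snocEquiv fun _ : Fin (n + 1) => Bool).sum_comp, Fintype.sum_prod_type_right]
  rfl

lemma productVec_snoc (B : MeasurementSystem) {n : ℕ} (τ x : BitStr n) (b c : Bool) :
    productVec B (snocBit τ b) (snocBit x c) = productVec B τ x * B n b c := by
  simp [productVec, snocBit, Fin.prod_univ_castSucc]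

/-- The outcome probabilities form a premeasure. -/
lemma outcomeProb_snoc (ρ : QState) (B : MeasurementSystem) {n : ℕ} (τ : BitStr n) :
    ∑ b, outcomeProb ρ B (snocBit τ b) = outcomeProb ρ B τ := by
  simp only [outcomeProb_eq, ← Complex.re_sum]
  congr 1
  rw [← ρ.coherent n]
  simp only [sum_bitStr_succ, productVec_snoc, partialTrace]
  have key : ∀ (x : BitStr n) (c : Bool) (y : BitStr n) (d : Bool),
      ∑ b, ρ.mat (n + 1) (snocBit x c) (snocBit y d) *
        (productVec B τ y * B n b d * star (productVec B τ x * B n b c))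
      = if d = c then ρ.mat (n + 1) (snocBit x c) (snocBit y d) *
        (productVec B τ y * star (productVec B τ x)) else 0 := by
    intro x c y d
    have h := sum_basis_mul_star (B n) d c
    calc _ = ρ.mat (n + 1) (snocBit x c) (snocBit y d) *
          (productVec B τ y * star (productVec B τ x)) * ∑ b, B n b d * star (B n b c) := by
          rw [Finset.mul_sum]
          refine Finset.sum_congr rfl fun b _ => ?_
          rw [star_mul']
          ring
      _ = _ := by rw [h]; split_ifs <;> simp
  rw [Finset.sum_comm]
  refine Finset.sum_congr rfl fun x _ => ?_
  rw [Finset.sum_comm]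
  simp_rw [Finset.sum_mul]
  have : ∀ c : Bool, ∑ b, ∑ y, ∑ d, ρ.mat (n + 1) (snocBit x c) (snocBit y d) *
        (productVec B τ y * B n b d * star (productVec B τ x * B n b c))
      = ∑ y, ρ.mat (n + 1) (snocBit x c) (snocBit y c) *
        (productVec B τ y * star (productVec B τ x)) := by
    intro c
    rw [Finset.sum_comm]
    refine Finset.sum_congr rfl fun y _ => ?_
    rw [Finset.sum_comm]
    simp_rw [key]
    simp
  simp_rw [this]
  rw [Finset.sum_comm]

/-- Extend a finite string by zeros. -/
def extendZero {n : ℕ} (τ : BitStr n) : Cantor := fun i => if h : i < n then τ ⟨i, h⟩ else false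

/-- Finitely supported approximations of the measure given by a premeasure. -/
def approxMeasure (ρ : QState) (B : MeasurementSystem) (n : ℕ) : Measure Cantor :=
  ∑ τ : BitStr n, ENNReal.ofReal (outcomeProb ρ B τ) • Measure.dirac (extendZero τ)

lemma measurableSet_cyl {n : ℕ} (σ : BitStr n) : MeasurableSet (cyl σ) := by
  have : cyl σ = ⋂ i : Fin n, (fun X : Cantor => X i) ⁻¹' {σ i} := by
    ext X; simp [cyl]
  rw [this]
  exact MeasurableSet.iInter fun i => measurable_pi_apply _ (measurableSet_singleton _)

lemma isClopen_cyl {n : ℕ} (σ : BitStr n) : IsClopen (cyl σ) := by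
  have : cyl σ = ⋂ i : Fin n, (fun X : Cantor => X i) ⁻¹' {σ i} := by
    ext X; simp [cyl]
  rw [this]
  exact isClopen_iInter_of_finite fun i => (isClopen_discrete _).preimage (continuous_apply _)

open Classical in
lemma approxMeasure_cyl (ρ : QState) (B : MeasurementSystem) {n : ℕ} (σ : BitStr n) (N : ℕ)
    (hN : n ≤ N) : approxMeasure ρ B N (cyl σ) = ENNReal.ofReal (outcomeProb ρ B σ) := by
  have hform : ∀ N, approxMeasure ρ B N (cyl σ) = ∑ τ : BitStr N,
      if extendZero τ ∈ cyl σ then ENNReal.ofReal (outcomeProb ρ B τ) else 0 := by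
    intro N
    simp [approxMeasure, Measure.finsetSum_apply, Measure.dirac_apply' _ (measurableSet_cyl σ),
      Set.indicator_apply]
  induction N, hN using Nat.le_induction with
  | base =>
    rw [hform]
    have : ∀ τ : BitStr n, extendZero τ ∈ cyl σ ↔ τ = σ := by
      intro τ
      simp [cyl, extendZero, funext_iff]
    simp [this]
  | succ N hN ih =>
    rw [← ih, hform, hform, sum_bitStr_succ]
    refine Finset.sum_congr rfl fun τ _ => ?_
    have : ∀ b, extendZero (snocBit τ b) ∈ cyl σ ↔ extendZero τ ∈ cyl σ := by
      intro b
      refine forall_congr' fun i => ?_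
      have h1 : (i : ℕ) < N := lt_of_lt_of_le i.2 hN
      have h2 : (i : ℕ) < N + 1 := by omega
      simp [extendZero, h1, h2, snocBit, Fin.snoc]
    simp only [this]
    split_ifs
    · rw [← outcomeProb_snoc, ENNReal.ofReal_sum_of_nonneg fun b _ => outcomeProb_nonneg ρ B _]
    · simp

lemma cyl_zero (σ : BitStr 0) : cyl σ = Set.univ := by
  ext X; simp [cyl]

lemma isProbabilityMeasure_approxMeasure (ρ : QState) (B : MeasurementSystem) (n : ℕ) :
    IsProbabilityMeasure (approxMeasure ρ B n) := by
  constructor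
  rw [← cyl_zero (fun i => i.elim0), approxMeasure_cyl ρ B _ n (Nat.zero_le n), outcomeProb_zero]
  simp

lemma exists_measurementMeasure (ρ : QState) (B : MeasurementSystem) :
    ∃ μ : Measure Cantor, IsProbabilityMeasure μ ∧
      ∀ (n : ℕ) (τ : BitStr n), μ (cyl τ) = ENNReal.ofReal (outcomeProb ρ B τ) := by
  let P : ℕ → ProbabilityMeasure Cantor := fun n =>
    ⟨approxMeasure ρ B n, isProbabilityMeasure_approxMeasure ρ B n⟩
  obtain ⟨μ, -, hμ⟩ := (isCompact_univ (X := ProbabilityMeasure Cantor)).ultrafilter_le_nhds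
    (Ultrafilter.map P (hyperfilter ℕ)) (by simp)
  have hT : Tendsto P (hyperfilter ℕ : Filter ℕ) (𝓝 μ) := hμ
  refine ⟨μ, inferInstance, fun n τ => ?_⟩
  have h1 : Tendsto (fun i => (P i : Measure Cantor) (cyl τ)) (hyperfilter ℕ : Filter ℕ)
      (𝓝 ((μ : Measure Cantor) (cyl τ))) :=
    ProbabilityMeasure.tendsto_measure_of_null_frontier_of_tendsto' hT
      (by simp [(isClopen_cyl τ).frontier_eq])
  have h2 : Tendsto (fun i => (P i : Measure Cantor) (cyl τ)) (hyperfilter ℕ : Filter ℕ)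
      (𝓝 (ENNReal.ofReal (outcomeProb ρ B τ))) := by
    refine tendsto_const_nhds.congr' ?_
    have : ∀ᶠ i in (hyperfilter ℕ : Filter ℕ), n ≤ i :=
      (Nat.hyperfilter_le_atTop) (eventually_ge_atTop n)
    filter_upwards [this] with i hi
    exact (approxMeasure_cyl ρ B τ i hi).symm
  exact tendsto_nhds_unique h1 h2

/-- The probability measure `μ^B_ρ` on Cantor space that measuring `ρ` qubit by qubit in `B`
induces: the probability measure with `μ (cyl τ) = p(τ)` for all finite strings `τ`. It is unique,
see `measurementMeasure_unique`. -/
def measurementMeasure (ρ : QState) (B : MeasurementSystem) : Measure Cantor :=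
  Classical.choose (exists_measurementMeasure ρ B)

instance (ρ : QState) (B : MeasurementSystem) : IsProbabilityMeasure (measurementMeasure ρ B) :=
  (Classical.choose_spec (exists_measurementMeasure ρ B)).1

lemma measurementMeasure_cyl (ρ : QState) (B : MeasurementSystem) {n : ℕ} (τ : BitStr n) :
    measurementMeasure ρ B (cyl τ) = ENNReal.ofReal (outcomeProb ρ B τ) :=
  (Classical.choose_spec (exists_measurementMeasure ρ B)).2 n τ

lemma measurementMeasure_unique (ρ : QState) (B : MeasurementSystem) (ν : Measure Cantor)
    (hν : ∀ (n : ℕ) (τ : BitStr n), ν (cyl τ) = ENNReal.ofReal (outcomeProb ρ B τ)) :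
    ν = measurementMeasure ρ B := by
  have huniv : ν Set.univ = 1 := by
    rw [← cyl_zero (fun i => i.elim0), hν, outcomeProb_zero]; simp
  have : IsProbabilityMeasure ν := ⟨huniv⟩
  refine ext_of_generate_finite (measurableCylinders fun _ : ℕ => Bool)
    generateFrom_measurableCylinders.symm isPiSystem_measurableCylinders ?_ (by simp)
  intro s hs
  rw [measurableCylinders_nat] at hs
  simp only [Set.mem_iUnion, Set.mem_singleton_iff] at hs
  obtain ⟨a, S, -, rfl⟩ := hs
  have hU : cylinder (Finset.Iic a) S = ⋃ τ ∈ {τ : BitStr (a + 1) |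
      extendZero τ ∈ cylinder (Finset.Iic a) S}, cyl τ := by
    ext X
    have hX : ∀ τ : BitStr (a + 1), X ∈ cyl τ →
        (Finset.Iic a).restrict X = (Finset.Iic a).restrict (extendZero τ) := by
      intro τ h
      ext ⟨i, hi⟩
      have hi' : i < a + 1 := by simpa [Nat.lt_succ_iff] using hi
      simpa [extendZero, hi'] using h ⟨i, hi'⟩
    simp only [Set.mem_iUnion, Set.mem_ofPred_eq, mem_cylinder, exists_prop]
    constructor
    · intro h
      have hc : X ∈ cyl (fun i : Fin (a + 1) => X i) := fun i => rfl
      exact ⟨_, by rw [← hX _ hc]; exact h, hc⟩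
    · rintro ⟨τ, h1, h2⟩
      rw [hX τ h2]; exact h1
  have hd : {τ : BitStr (a + 1) | extendZero τ ∈ cylinder (Finset.Iic a) S}.PairwiseDisjoint
      (fun τ => cyl τ) := by
    intro τ _ τ' _ hne
    rw [Function.onFun, Set.disjoint_left]
    intro X h h'
    exact hne (funext fun i => (h i).symm.trans (h' i))
  rw [hU, measure_biUnion (Set.to_countable _) hd fun τ _ => measurableSet_cyl τ,
    measure_biUnion (Set.to_countable _) hd fun τ _ => measurableSet_cyl τ]
  simp only [hν, measurementMeasure_cyl]

/-- A state is measurement random if measuring it qubit by qubit in any computable measurement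
system gives a Martin-Löf random sequence with probability one. -/
def QState.IsMeasurementRandom (ρ : QState) : Prop :=
  ∀ B : MeasurementSystem, IsComputableSystem B → measurementMeasure ρ B MLR = 1

end

noncomputable section

open MeasureTheory Filter Topology Matrix Polynomial
open scoped ComplexOrder Kronecker

/-! ### Primitive recursive integer arithmetic -/

/-! A classical Martin-Löf test, read through the measurement system `B`, becomes a quantum
Martin-Löf test. A finite set `C` of strings of length n corresponds to the projection `projSet B C`
onto the span of the product vectors of its strings. These vectors are orthonormal, so the rank of
the projection is the number of strings in `C`, and its trace against ρ_n is the probability that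
the measured bits begin with a string in `C`. Since the basis of each new qubit is complete,
tensoring with the identity replaces every string by its two extensions, so increasing clopen sets
give increasing ranges. In the limit, τ and ρ of the quantum class are the uniform measure and the
measurement measure of the classical class (`IsMLTest.exists_isQMLTest`). Quantum randomness of ρ
therefore makes the intersection of every classical test null for the measurement measure. There are
only countably many tests, so the complement of `MLR` is null as well; no universal test is needed.

Most of the work lies in showing that the projections are computable. Their entries are finite sums
of products of the given algebraic numbers and their conjugates, so codes have to be added,
multiplied and conjugated. Sums and products are found by unbounded search for a certificate whose
validity is primitive recursive. A certificate for s(α, β) consists of an integer polynomial P, a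
bivariate polynomial identity forcing P to vanish at s(α, β), a disc on which a derivative bound
makes P injective, and approximations of α and β that place s(α, β) in this disc.
`AlgCode.IsCertificate.names` is soundness. `AlgCode.exists_isCertificate` is completeness; it rests
on `BiList.exists_annihilates`, which supplies a P with only simple roots. -/

lemma Int.encode_natCast (n : ℕ) : Encodable.encode (n : ℤ) = 2 * n := rfl

lemma Int.encode_negSucc (n : ℕ) : Encodable.encode (Int.negSucc n) = 2 * n + 1 := rfl

/-- The encoding of `ℤ` puts nonnegative integers at even codes and negative ones at odd codes: the
parity of the code is the sign, and half of it gives the absolute value up to a shift. -/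
lemma Primrec.int_toNat : Primrec Int.toNat := by
  refine (Primrec.cond (Primrec.nat_bodd.comp Primrec.encode) (Primrec.const 0)
    (Primrec.nat_div2.comp Primrec.encode)).of_eq fun z => ?_
  cases z with
  | ofNat n => simp [Int.encode_natCast, Nat.div2_val]
  | negSucc n => simp [Int.encode_negSucc]

lemma Primrec.int_toNat_neg : Primrec fun z : ℤ => (-z).toNat := by
  refine (Primrec.cond (Primrec.nat_bodd.comp Primrec.encode)
    (Primrec.succ.comp (Primrec.nat_div2.comp Primrec.encode)) (Primrec.const 0)).of_eq fun z => ?_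
  cases z with
  | ofNat n => simp [Int.encode_natCast]
  | negSucc n =>
    simp [Int.encode_negSucc, Nat.div2_val]

/-- Negation, sums and products below write z as the difference of the naturals `z.toNat` and
`(-z).toNat`, compute with naturals, and return to `ℤ` through this subtraction. -/
lemma Primrec.int_subNat : Primrec₂ fun a b : ℕ => (a : ℤ) - b := by
  refine Primrec.encode_iff.1 ((Primrec.ite (Primrec.nat_le.comp Primrec.snd Primrec.fst)
    (Primrec.nat_double.comp (Primrec.nat_sub.comp Primrec.fst Primrec.snd))
    (Primrec.nat_double_succ.comp (Primrec.pred.comp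
      (Primrec.nat_sub.comp Primrec.snd Primrec.fst)))).of_eq fun p => ?_)
  obtain ⟨a, b⟩ := p
  dsimp only
  split_ifs with h
  · have : (a : ℤ) - b = ((a - b : ℕ) : ℤ) := by omega
    rw [this, Int.encode_natCast]
  · have : (a : ℤ) - b = Int.negSucc (b - a - 1) := by omega
    rw [this, Int.encode_negSucc]
    rfl

lemma Primrec.int_natCast : Primrec fun n : ℕ => (n : ℤ) :=
  (Primrec.int_subNat.comp Primrec.id (Primrec.const 0)).of_eq fun n => by simp

lemma Primrec.int_natAbs : Primrec Int.natAbs :=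
  (Primrec.nat_add.comp Primrec.int_toNat Primrec.int_toNat_neg).of_eq fun z => by omega

lemma Primrec.int_neg : Primrec fun z : ℤ => -z :=
  (Primrec.int_subNat.comp Primrec.int_toNat_neg Primrec.int_toNat).of_eq fun z => by omega

lemma Primrec.int_add : Primrec₂ fun a b : ℤ => a + b := by
  refine (Primrec.int_subNat.comp
    (Primrec.nat_add.comp (Primrec.int_toNat.comp Primrec.fst) (Primrec.int_toNat.comp Primrec.snd))
    (Primrec.nat_add.comp (Primrec.int_toNat_neg.comp Primrec.fst)
      (Primrec.int_toNat_neg.comp Primrec.snd))).of_eq fun p => ?_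
  dsimp only
  omega

lemma Primrec.int_mul : Primrec₂ fun a b : ℤ => a * b := by
  have h1 := Primrec.int_toNat
  have h2 := Primrec.int_toNat_neg
  refine (Primrec.int_subNat.comp
    (Primrec.nat_add.comp
      (Primrec.nat_mul.comp (h1.comp Primrec.fst) (h1.comp Primrec.snd))
      (Primrec.nat_mul.comp (h2.comp Primrec.fst) (h2.comp Primrec.snd)))
    (Primrec.nat_add.comp
      (Primrec.nat_mul.comp (h1.comp Primrec.fst) (h2.comp Primrec.snd))
      (Primrec.nat_mul.comp (h2.comp Primrec.fst) (h1.comp Primrec.snd)))).of_eq fun p => ?_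
  obtain ⟨a, b⟩ := p
  have key : ∀ z : ℤ, z = z.toNat - (-z).toNat := fun z => by omega
  dsimp only
  conv_rhs => rw [key a, key b]
  push_cast
  ring

lemma Primrec.nat_pow : Primrec₂ fun a b : ℕ => a ^ b :=
  Primrec₂.unpaired'.1 Nat.Primrec.pow

/-! ### Unbounded search -/

/-- A witness of a primitive recursive relation can be found by a partial recursive search. -/
theorem PrimrecRel.exists_partrec_search {α β : Type*} [Primcodable α] [Primcodable β]
    {R : α → β → Prop} (hR : PrimrecRel R) :
    ∃ F : α →. β, Partrec F ∧ (∀ a, ∀ b ∈ F a, R a b) ∧ ∀ a, (∃ b, R a b) → (F a).Dom := by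
  classical
  let g : α → ℕ → Option β := fun a n =>
    (Encodable.decode (α := β) n).bind fun b => if R a b then some b else none
  have hg : Primrec₂ g := by
    refine Primrec.option_bind (Primrec.decode.comp Primrec.snd) ?_
    exact Primrec.ite (hR.comp (Primrec.fst.comp Primrec.fst) Primrec.snd)
      (Primrec.option_some.comp Primrec.snd) (Primrec.const none)
  refine ⟨fun a => Nat.rfindOpt (g a), Partrec.rfindOpt hg.to_comp, fun a b hb => ?_, ?_⟩
  · obtain ⟨n, hn⟩ := Nat.rfindOpt_spec hb
    obtain ⟨b', -, h⟩ := Option.bind_eq_some_iff.1 hn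
    split_ifs at h with h1
    obtain rfl := Option.some_inj.1 h
    exact h1
  · rintro a ⟨b, hb⟩
    exact Nat.rfindOpt_dom.2 ⟨Encodable.encode b, b, by simp [g, hb]⟩

/-! ### Integer polynomials given by coefficient lists -/

@[simp] lemma polyOfList_nil : polyOfList [] = 0 := rfl

@[simp] lemma polyOfList_cons (a : ℤ) (l : List ℤ) :
    polyOfList (a :: l) = C a + X * polyOfList l := rfl

lemma aeval_polyOfList_cons {A : Type*} [CommRing A] (z : A) (a : ℤ) (l : List ℤ) :
    aeval z (polyOfList (a :: l)) = a + z * aeval z (polyOfList l) := by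
  simp

lemma aeval_derivative_polyOfList_cons {A : Type*} [CommRing A] (z : A) (a : ℤ) (l : List ℤ) :
    aeval z (derivative (polyOfList (a :: l)))
      = aeval z (polyOfList l) + z * aeval z (derivative (polyOfList l)) := by
  simp

lemma degree_polyOfList_lt (l : List ℤ) : (polyOfList l).degree < l.length := by
  induction l with
  | nil => simp
  | cons a l ih =>
    rw [polyOfList_cons]
    refine (degree_add_le _ _).trans_lt (max_lt (degree_C_le.trans_lt ?_) ?_)
    · exact_mod_cast Nat.succ_pos _
    · rcases eq_or_ne (polyOfList l) 0 with h | h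
      · simp [h]
      · rw [degree_mul, degree_X, degree_eq_natDegree h] at *
        have : (polyOfList l).natDegree < l.length := by exact_mod_cast ih
        have : 1 + (polyOfList l).natDegree < (a :: l).length := by simp; omega
        exact_mod_cast this

lemma exists_polyOfList (p : ℤ[X]) : ∃ l, polyOfList l = p := by
  have key : ∀ (n : ℕ) (p : ℤ[X]), p.natDegree < n → ∃ l, polyOfList l = p := by
    intro n
    induction n with
    | zero => intro p h; omega
    | succ n ih =>
      intro p hp
      rcases Nat.eq_zero_or_pos p.natDegree with h | h
      · exact ⟨[p.coeff 0], by simp [← eq_C_of_natDegree_eq_zero h]⟩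
      · obtain ⟨l, hl⟩ := ih p.divX (by rw [natDegree_divX_eq_natDegree_tsub_one]; omega)
        exact ⟨p.coeff 0 :: l, by rw [polyOfList_cons, hl, add_comm, X_mul_divX_add]⟩
  exact key _ p (Nat.lt_succ_self _)

/-- A polynomial that is small at `z` has a root near `z`. -/
lemma exists_root_near (l : List ℤ) (hl : polyOfList l ≠ 0) (z : ℂ) {r : ℝ} (hr : 0 < r)
    (hr1 : r ≤ 1) (hz : ‖aeval z (polyOfList l)‖ < r ^ l.length) :
    ∃ w : ℂ, aeval w (polyOfList l) = 0 ∧ ‖w - z‖ < r := by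
  set p : ℂ[X] := (polyOfList l).map (algebraMap ℤ ℂ) with hp
  have hinj : Function.Injective (algebraMap ℤ ℂ) := (algebraMap ℤ ℂ).injective_int
  have hp0 : p ≠ 0 := (Polynomial.map_ne_zero_iff hinj).2 hl
  have hsplit : p.Splits := IsAlgClosed.splits p
  have hev : ∀ w : ℂ, aeval w (polyOfList l) = p.eval w := fun w => by
    rw [hp, eval_map_algebraMap]
  -- If every root had distance at least `r` from `z`, the factorisation over ℂ would bound the
  -- value below by `r ^ l.length`: there are at most `l.length` factors, `r ≤ 1`, and the leading
  -- coefficient, a nonzero integer, has absolute value at least 1.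
  by_contra! hcon
  have hroots : ∀ w ∈ p.roots, r ≤ ‖z - w‖ := by
    intro w hw
    rw [norm_sub_rev]
    exact hcon w (by rw [hev]; exact (mem_roots hp0).1 hw)
  have hlead : 1 ≤ ‖p.leadingCoeff‖ := by
    rw [hp, leadingCoeff_map_of_injective hinj]
    have h1 : (1 : ℤ) ≤ |(polyOfList l).leadingCoeff| :=
      Int.one_le_abs (leadingCoeff_ne_zero.2 hl)
    have : ‖(algebraMap ℤ ℂ) (polyOfList l).leadingCoeff‖
        = ((|(polyOfList l).leadingCoeff| : ℤ) : ℝ) := by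
      simp
    rw [this]
    exact_mod_cast h1
  have hprod : ∀ s : Multiset ℂ, (∀ w ∈ s, r ≤ ‖z - w‖) →
      r ^ Multiset.card s ≤ ‖(s.map fun w => z - w).prod‖ := by
    intro s
    induction s using Multiset.induction_on with
    | empty => simp
    | cons a s ih =>
      intro h
      rw [Multiset.map_cons, Multiset.prod_cons, Multiset.card_cons, pow_succ', norm_mul]
      exact mul_le_mul (h a (Multiset.mem_cons_self a s))
        (ih fun w hw => h w (Multiset.mem_cons_of_mem hw)) (by positivity) (norm_nonneg _)
  have hcard : Multiset.card p.roots ≤ l.length := by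
    refine (card_roots' p).trans (natDegree_map_le.trans ?_)
    have := degree_polyOfList_lt l
    rw [degree_eq_natDegree hl] at this
    exact_mod_cast this.le
  rw [hev, hsplit.eval_eq_prod_roots, norm_mul] at hz
  have h1 := hprod p.roots hroots
  have h2 : r ^ l.length ≤ r ^ Multiset.card p.roots := pow_le_pow_of_le_one hr.le hr1 hcard
  nlinarith [norm_nonneg (p.roots.map fun w => z - w).prod]

/-! ### Injectivity of a polynomial near a point where the derivative is large -/

/-- Bounds, valid on the disc of radius `M` around `0`, of the values of a polynomial, of its
Lipschitz constant, and of the Lipschitz constant of its difference quotients. -/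
def growthBound (M : ℕ) (l : List ℤ) : ℕ × ℕ × ℕ :=
  l.foldr (fun a s => (a.natAbs + M * s.1, s.1 + M * s.2.1, 2 * s.2.1 + M * s.2.2)) (0, 0, 0)

lemma growthBound_cons (M : ℕ) (a : ℤ) (l : List ℤ) :
    growthBound M (a :: l) = (a.natAbs + M * (growthBound M l).1,
      (growthBound M l).1 + M * (growthBound M l).2.1,
      2 * (growthBound M l).2.1 + M * (growthBound M l).2.2) := rfl

lemma norm_aeval_le_growthBound {M : ℕ} {z : ℂ} (hz : ‖z‖ ≤ M) (l : List ℤ) :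
    ‖aeval z (polyOfList l)‖ ≤ (growthBound M l).1 := by
  induction l with
  | nil => simp
  | cons a l ih =>
    rw [aeval_polyOfList_cons, growthBound_cons]
    push_cast
    refine (norm_add_le _ _).trans (add_le_add ?_ ?_)
    · simp
    · rw [norm_mul]
      exact mul_le_mul hz ih (norm_nonneg _) (Nat.cast_nonneg _)

lemma norm_aeval_derivative_le_growthBound {M : ℕ} {z : ℂ} (hz : ‖z‖ ≤ M) (l : List ℤ) :
    ‖aeval z (derivative (polyOfList l))‖ ≤ (growthBound M l).2.1 := by
  induction l with
  | nil => simp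
  | cons a l ih =>
    rw [aeval_derivative_polyOfList_cons, growthBound_cons]
    push_cast
    refine (norm_add_le _ _).trans (add_le_add (norm_aeval_le_growthBound hz l) ?_)
    rw [norm_mul]
    exact mul_le_mul hz ih (norm_nonneg _) (Nat.cast_nonneg _)

lemma norm_aeval_sub_le_growthBound {M : ℕ} {z w : ℂ} (hz : ‖z‖ ≤ M) (hw : ‖w‖ ≤ M)
    (l : List ℤ) : ‖aeval z (polyOfList l) - aeval w (polyOfList l)‖
      ≤ (growthBound M l).2.1 * ‖z - w‖ := by
  induction l with
  | nil => simp [growthBound]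
  | cons a l ih =>
    rw [aeval_polyOfList_cons, aeval_polyOfList_cons, growthBound_cons]
    have : (a : ℂ) + z * aeval z (polyOfList l) - (a + w * aeval w (polyOfList l))
        = aeval z (polyOfList l) * (z - w)
          + w * (aeval z (polyOfList l) - aeval w (polyOfList l)) := by ring
    rw [this]
    push_cast
    rw [add_mul, mul_assoc]
    refine (norm_add_le _ _).trans (add_le_add ?_ ?_) <;> rw [norm_mul]
    · exact mul_le_mul_of_nonneg_right (norm_aeval_le_growthBound hz l) (norm_nonneg _)
    · exact mul_le_mul hw ih (norm_nonneg _) (Nat.cast_nonneg _)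

/-- The quotient obeys a Horner recursion: if `Q` belongs to p, then p(z) + w Q belongs to a + X p.
Compared with the derivative p(c) + c p'(c), the error splits into p(z) - p(c), w (Q - p'(c)) and (w
- c) p'(c). The first and the last are each controlled by the Lipschitz bound, which explains the
factor 2 in `growthBound`. -/
lemma exists_difference_quotient {M : ℕ} {z w c : ℂ} {r : ℝ} (hz : ‖z‖ ≤ M) (hw : ‖w‖ ≤ M)
    (hc : ‖c‖ ≤ M) (hzr : ‖z - c‖ ≤ r) (hwr : ‖w - c‖ ≤ r) (l : List ℤ) :
    ∃ Q : ℂ, aeval z (polyOfList l) - aeval w (polyOfList l) = (z - w) * Q ∧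
      ‖Q - aeval c (derivative (polyOfList l))‖ ≤ (growthBound M l).2.2 * r := by
  have hr : 0 ≤ r := (norm_nonneg _).trans hzr
  induction l with
  | nil => exact ⟨0, by simp [growthBound]⟩
  | cons a l ih =>
    obtain ⟨Q, hQ, hQr⟩ := ih
    refine ⟨aeval z (polyOfList l) + w * Q, ?_, ?_⟩
    · rw [aeval_polyOfList_cons, aeval_polyOfList_cons]
      linear_combination w * hQ
    · rw [aeval_derivative_polyOfList_cons, growthBound_cons]
      have : aeval z (polyOfList l) + w * Q - (aeval c (polyOfList l)
            + c * aeval c (derivative (polyOfList l)))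
          = (aeval z (polyOfList l) - aeval c (polyOfList l))
            + w * (Q - aeval c (derivative (polyOfList l)))
            + (w - c) * aeval c (derivative (polyOfList l)) := by ring
      rw [this]
      have h1 := (norm_aeval_sub_le_growthBound hz hc l).trans
        (mul_le_mul_of_nonneg_left hzr (Nat.cast_nonneg _))
      have h2 : ‖w * (Q - aeval c (derivative (polyOfList l)))‖
          ≤ M * ((growthBound M l).2.2 * r) := by
        rw [norm_mul]; exact mul_le_mul hw hQr (norm_nonneg _) (Nat.cast_nonneg _)
      have h3 : ‖(w - c) * aeval c (derivative (polyOfList l))‖ ≤ r * (growthBound M l).2.1 := by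
        rw [norm_mul]
        exact mul_le_mul hwr (norm_aeval_derivative_le_growthBound hc l) (norm_nonneg _) hr
      push_cast
      refine (norm_add₃_le).trans ?_
      linarith

/-- For distinct roots the difference quotient would be zero, yet it is closer to the derivative at
`c` than the size of that derivative. -/
lemma eq_of_roots_of_growthBound_lt {M : ℕ} {z w c : ℂ} {r : ℝ} (hz : ‖z‖ ≤ M) (hw : ‖w‖ ≤ M)
    (hc : ‖c‖ ≤ M) (hzr : ‖z - c‖ ≤ r) (hwr : ‖w - c‖ ≤ r) {l : List ℤ}
    (hl : (growthBound M l).2.2 * r < ‖aeval c (derivative (polyOfList l))‖)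
    (hz0 : aeval z (polyOfList l) = 0) (hw0 : aeval w (polyOfList l) = 0) : z = w := by
  obtain ⟨Q, hQ, hQr⟩ := exists_difference_quotient hz hw hc hzr hwr l
  rw [hz0, hw0, sub_zero, eq_comm, mul_eq_zero] at hQ
  rcases hQ with h | rfl
  · exact sub_eq_zero.1 h
  · rw [zero_sub, norm_neg] at hQr
    exact absurd hl (not_lt.2 hQr)

/-! ### Dyadic Gaussian rationals -/

/-- The triple `(a, b, k)` stands for `(a + b i) / 2 ^ k`. -/
abbrev GDyadic : Type := ℤ × ℤ × ℕ

namespace GDyadic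

/-- The complex number a triple stands for. -/
def val (z : GDyadic) : ℂ := ((z.1 : ℂ) + (z.2.1 : ℂ) * Complex.I) / 2 ^ z.2.2

/-- Sum. -/
def add (z w : GDyadic) : GDyadic :=
  (z.1 * (2 ^ w.2.2 : ℕ) + w.1 * (2 ^ z.2.2 : ℕ),
    z.2.1 * (2 ^ w.2.2 : ℕ) + w.2.1 * (2 ^ z.2.2 : ℕ), z.2.2 + w.2.2)

/-- Negation. -/
def neg (z : GDyadic) : GDyadic := (-z.1, -z.2.1, z.2.2)

/-- Product. -/
def mul (z w : GDyadic) : GDyadic :=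
  (z.1 * w.1 + -(z.2.1 * w.2.1), z.1 * w.2.1 + z.2.1 * w.1, z.2.2 + w.2.2)

/-- The number `2 ^ (-k)`. -/
def invPow (k : ℕ) : GDyadic := (1, 0, k)

/-- Comparison of absolute values. -/
def NormLt (z w : GDyadic) : Prop :=
  (z.1.natAbs * z.1.natAbs + z.2.1.natAbs * z.2.1.natAbs) * 4 ^ w.2.2
    < (w.1.natAbs * w.1.natAbs + w.2.1.natAbs * w.2.1.natAbs) * 4 ^ z.2.2

@[simp] lemma val_add (z w : GDyadic) : (z.add w).val = z.val + w.val := by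
  simp only [val, add]
  push_cast
  field_simp
  ring

@[simp] lemma val_neg (z : GDyadic) : z.neg.val = -z.val := by
  simp only [val, neg]
  push_cast
  ring

@[simp] lemma val_mul (z w : GDyadic) : (z.mul w).val = z.val * w.val := by
  simp only [val, mul]
  push_cast
  rw [div_mul_div_comm, ← pow_add]
  congr 1
  linear_combination (-(z.2.1 : ℂ) * w.2.1) * Complex.I_sq

@[simp] lemma val_invPow (k : ℕ) : (invPow k).val = 1 / 2 ^ k := by
  simp [val, invPow]

lemma norm_val_sq (z : GDyadic) : ‖z.val‖ ^ 2
    = ((z.1.natAbs * z.1.natAbs + z.2.1.natAbs * z.2.1.natAbs : ℕ) : ℝ) / 4 ^ z.2.2 := by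
  have h1 : ∀ n : ℤ, ((n.natAbs : ℕ) : ℝ) * (n.natAbs : ℝ) = n * n := fun n => by
    rw [Nat.cast_natAbs]
    push_cast
    exact abs_mul_abs_self _
  rw [val, norm_div, div_pow, norm_pow, Complex.norm_two, ← pow_mul, mul_comm z.2.2 2, pow_mul,
    Complex.sq_norm]
  push_cast
  rw [h1, h1]
  norm_num [Complex.normSq_apply]

lemma normLt_iff (z w : GDyadic) : NormLt z w ↔ ‖z.val‖ < ‖w.val‖ := by
  rw [← sq_lt_sq₀ (norm_nonneg _) (norm_nonneg _), norm_val_sq, norm_val_sq,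
    div_lt_div_iff₀ (by positivity) (by positivity), NormLt]
  exact_mod_cast Iff.rfl

/-- Value of an integer polynomial at a dyadic Gaussian rational, paired with the value of the
derivative. -/
def evalDeriv (z : GDyadic) (l : List ℤ) : GDyadic × GDyadic :=
  l.foldr (fun a s => (add (a, 0, 0) (mul z s.1), add s.1 (mul z s.2))) ((0, 0, 0), (0, 0, 0))

lemma val_evalDeriv_fst (z : GDyadic) (l : List ℤ) :
    (evalDeriv z l).1.val = aeval z.val (polyOfList l) := by
  induction l with
  | nil => simp [evalDeriv, val]
  | cons a l ih =>
    rw [aeval_polyOfList_cons, ← ih, ← val_mul]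
    change (add (a, 0, 0) (mul z (evalDeriv z l).1)).val = _
    rw [val_add]
    simp [val]

lemma val_evalDeriv_snd (z : GDyadic) (l : List ℤ) :
    (evalDeriv z l).2.val = aeval z.val (derivative (polyOfList l)) := by
  induction l with
  | nil => simp [evalDeriv, val]
  | cons a l ih =>
    rw [aeval_derivative_polyOfList_cons, ← ih, ← val_evalDeriv_fst, ← val_mul, ← val_add]
    rfl

/-- Dyadic Gaussian rationals with denominator `2 ^ k` come close to every complex number. -/
lemma exists_close (γ : ℂ) (k : ℕ) :
    ∃ a b : ℤ, ‖γ - val (a, b, k)‖ ≤ 23 / 32 * (1 / 2 ^ k) := by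
  -- Rounding both coordinates leaves an error of at most √2/2 in units of 2^(-k). The constant
  -- 23/32 is a rational number above √2/2 that stays below the 3/4 demanded by
  -- `AlgCode.IsCertificate`, with 1/32 to spare.
  refine ⟨round (γ.re * 2 ^ k), round (γ.im * 2 ^ k), ?_⟩
  set a := round (γ.re * 2 ^ k)
  set b := round (γ.im * 2 ^ k)
  have ha : |γ.re * 2 ^ k - a| ≤ 1 / 2 := abs_sub_round _
  have hb : |γ.im * 2 ^ k - b| ≤ 1 / 2 := abs_sub_round _
  have h2 : (0 : ℝ) < 2 ^ k := by positivity
  have hv : γ - val (a, b, k)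
      = (⟨γ.re * 2 ^ k - a, γ.im * 2 ^ k - b⟩ : ℂ) / ((2 ^ k : ℝ) : ℂ) := by
    have : (((2 ^ k : ℝ) : ℂ)) ≠ 0 := by exact_mod_cast h2.ne'
    rw [eq_div_iff this, sub_mul, val]
    have h3 : ((a : ℂ) + (b : ℂ) * Complex.I) / 2 ^ k * ((2 ^ k : ℝ) : ℂ)
        = (a : ℂ) + (b : ℂ) * Complex.I := by
      push_cast
      field_simp
    dsimp only
    rw [h3]
    apply Complex.ext <;> simp [-Complex.ofReal_pow]
  rw [hv, norm_div, Complex.norm_real, Real.norm_of_nonneg h2.le, div_eq_mul_one_div]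
  refine mul_le_mul_of_nonneg_right ?_ (by positivity)
  refine le_of_sq_le_sq ?_ (by norm_num)
  rw [Complex.sq_norm, Complex.normSq_apply]
  have h4 := abs_le.1 ha
  have h5 := abs_le.1 hb
  dsimp only
  nlinarith

end GDyadic

/-! ### Bivariate integer polynomials as lists of monomials -/

/-- A list of monomials `(c, i, j)`, standing for the polynomial `∑ c x ^ i y ^ j`. -/
abbrev BiList : Type := List (ℤ × ℕ × ℕ)

namespace BiList

section Eval

variable {S T : Type*} [CommRing S] [CommRing T]

/-- The value of a bivariate polynomial at a point. -/
def ev (x y : S) (l : BiList) : S := (l.map fun t => (t.1 : S) * x ^ t.2.1 * y ^ t.2.2).sum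

/-- Product of two lists of monomials. -/
def mul (l m : BiList) : BiList :=
  l.flatMap fun t => m.map fun u => (t.1 * u.1, t.2.1 + u.2.1, t.2.2 + u.2.2)

/-- Powers of a list of monomials. -/
def pow (l : BiList) (e : ℕ) : BiList := (mul l)^[e] [(1, 0, 0)]

/-- The substitution of a bivariate polynomial into an integer polynomial in one variable. -/
def subst (s : BiList) (l : List ℤ) : BiList := l.foldr (fun a m => (a, 0, 0) :: mul s m) []

@[simp] lemma ev_nil (x y : S) : ev x y [] = 0 := rfl

@[simp] lemma ev_cons (x y : S) (t : ℤ × ℕ × ℕ) (l : BiList) :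
    ev x y (t :: l) = (t.1 : S) * x ^ t.2.1 * y ^ t.2.2 + ev x y l := by
  simp [ev]

@[simp] lemma ev_append (x y : S) (l m : BiList) : ev x y (l ++ m) = ev x y l + ev x y m := by
  simp [ev]

lemma ev_map_mul (x y : S) (t : ℤ × ℕ × ℕ) (m : BiList) :
    ev x y (m.map fun u => (t.1 * u.1, t.2.1 + u.2.1, t.2.2 + u.2.2))
      = (t.1 : S) * x ^ t.2.1 * y ^ t.2.2 * ev x y m := by
  induction m with
  | nil => simp
  | cons u m ih =>
    rw [List.map_cons, ev_cons, ih, ev_cons]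
    push_cast
    ring

@[simp] lemma ev_mul (x y : S) (l m : BiList) : ev x y (mul l m) = ev x y l * ev x y m := by
  induction l with
  | nil => simp [mul]
  | cons t l ih =>
    rw [mul, List.flatMap_cons, ev_append, ev_map_mul, ev_cons, add_mul, ← ih, mul]

@[simp] lemma ev_pow (x y : S) (l : BiList) (e : ℕ) : ev x y (pow l e) = ev x y l ^ e := by
  induction e with
  | zero => simp [pow]
  | succ e ih =>
    rw [pow, Function.iterate_succ_apply', ev_mul, pow_succ', ← ih, pow]

@[simp] lemma ev_subst (x y : S) (s : BiList) (l : List ℤ) :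
    ev x y (subst s l) = aeval (ev x y s) (polyOfList l) := by
  induction l with
  | nil => simp [subst]
  | cons a l ih =>
    rw [aeval_polyOfList_cons, ← ih, ← ev_mul]
    simp [subst]

lemma map_ev (f : S →+* T) (x y : S) (l : BiList) : f (ev x y l) = ev (f x) (f y) l := by
  induction l with
  | nil => simp
  | cons t l ih => simp [ih]

lemma isIntegral_ev {K : Type*} [CommRing K] [Algebra K S] {x y : S} (hx : IsIntegral K x)
    (hy : IsIntegral K y) (l : BiList) : IsIntegral K (ev x y l) := by
  induction l with
  | nil => simpa using isIntegral_zero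
  | cons t l ih =>
    rw [ev_cons]
    have ht : IsIntegral K (t.1 : S) := by
      simpa using isIntegral_algebraMap (R := K) (A := S) (x := (t.1 : K))
    exact ((ht.mul (hx.pow _)).mul (hy.pow _)).add ih

end Eval

/-! ### Deciding whether a list of monomials stands for zero -/

/-- The sum of the coefficients of a given monomial. -/
def coeffSum (l : BiList) (e : ℕ × ℕ) : ℤ :=
  l.foldr (fun t c => if t.2 = e then t.1 + c else c) 0

/-- All monomials that occur in the list have total coefficient zero. -/
def IsZero (l : BiList) : Prop := ∀ t ∈ l, coeffSum l t.2 = 0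

/-- The polynomial a list of monomials stands for. -/
def toPoly (l : BiList) : ℚ[X][X] := ev (C X) X l

lemma coeff_toPoly (l : BiList) (i j : ℕ) :
    ((toPoly l).coeff j).coeff i = coeffSum l (i, j) := by
  unfold toPoly
  induction l with
  | nil => simp [coeffSum]
  | cons t l ih =>
    have h : (t.1 : ℚ[X][X]) * C X ^ t.2.1 * X ^ t.2.2
        = monomial t.2.2 (monomial t.2.1 (t.1 : ℚ)) := by
      rw [← C_mul_X_pow_eq_monomial, ← C_mul_X_pow_eq_monomial]
      simp
    have h2 : coeffSum (t :: l) (i, j)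
        = if t.2 = (i, j) then t.1 + coeffSum l (i, j) else coeffSum l (i, j) := rfl
    rw [ev_cons, h, coeff_add, coeff_add, ih, h2, coeff_monomial]
    obtain ⟨c, i', j'⟩ := t
    by_cases hj : j' = j
    · by_cases hi : i' = i
      · simp [hi, hj]
      · simp [hj, hi, coeff_monomial]
    · simp [hj]

/-- A monomial that does not occur in the list has coefficient sum zero anyway, so the finite check
over the listed monomials decides the identity of polynomials. -/
lemma isZero_iff (l : BiList) : IsZero l ↔ (toPoly l) = 0 := by
  constructor
  · intro h
    ext j i
    rw [coeff_toPoly]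
    by_cases hm : ∃ t ∈ l, t.2 = (i, j)
    · obtain ⟨t, ht, he⟩ := hm
      rw [← he, h t ht]
      simp
    · have : ∀ m : BiList, (¬ ∃ t ∈ m, t.2 = (i, j)) → coeffSum m (i, j) = 0 := by
        intro m
        induction m with
        | nil => intro _; rfl
        | cons t m ih =>
          intro hn
          have ht : t.2 ≠ (i, j) := fun he => hn ⟨t, List.mem_cons_self, he⟩
          have h2 : coeffSum (t :: m) (i, j) = if t.2 = (i, j) then t.1 + coeffSum m (i, j)
            else coeffSum m (i, j) := rfl
          rw [h2, if_neg ht]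
          exact ih fun ⟨u, hu, he⟩ => hn ⟨u, List.mem_cons_of_mem _ hu, he⟩
      rw [this l hm]
      simp
  · rintro h ⟨c, i, j⟩ -
    have := coeff_toPoly l i j
    rw [h] at this
    simpa using this.symm

lemma IsZero.ev_eq_zero {l : BiList} (h : IsZero l) (α β : ℂ) : ev α β l = 0 := by
  have := map_ev (eval₂RingHom (aeval α : ℚ[X] →ₐ[ℚ] ℂ).toRingHom β) (C X) X l
  rw [← toPoly, (isZero_iff l).1 h, map_zero] at this
  simpa using this.symm

/-- Up to a nonzero integer factor every rational bivariate polynomial is given by a list. -/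
lemma exists_toPoly_eq_intCast_mul (f : ℚ[X][X]) :
    ∃ N : ℤ, N ≠ 0 ∧ ∃ l : BiList, toPoly l = (N : ℚ[X][X]) * f := by
  have hadd : ∀ f g : ℚ[X][X],
      (∃ N : ℤ, N ≠ 0 ∧ ∃ l : BiList, toPoly l = (N : ℚ[X][X]) * f) →
      (∃ N : ℤ, N ≠ 0 ∧ ∃ l : BiList, toPoly l = (N : ℚ[X][X]) * g) →
      ∃ N : ℤ, N ≠ 0 ∧ ∃ l : BiList, toPoly l = (N : ℚ[X][X]) * (f + g) := by
    rintro f g ⟨N, hN, l, hl⟩ ⟨M, hM, m, hm⟩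
    refine ⟨N * M, mul_ne_zero hN hM, mul [(M, 0, 0)] l ++ mul [(N, 0, 0)] m, ?_⟩
    rw [toPoly] at hl hm ⊢
    simp only [ev_append, ev_mul, hl, hm, ev_cons, ev_nil]
    push_cast
    ring
  induction f using Polynomial.induction_on' with
  | add f g hf hg => exact hadd f g hf hg
  | monomial j c =>
    induction c using Polynomial.induction_on' with
    | add f g hf hg => rw [map_add]; exact hadd _ _ hf hg
    | monomial i q =>
      refine ⟨q.den, by exact_mod_cast q.den_nz, [(q.num, i, j)], ?_⟩
      rw [← C_mul_X_pow_eq_monomial, ← C_mul_X_pow_eq_monomial]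
      have hq : (q.num : ℚ[X][X]) = (q.den : ℚ[X][X]) * C (C q) := by
        have h1 : (q.num : ℚ) = q.den * q := by rw [mul_comm, Rat.mul_den_eq_num]
        have h2 := congrArg (fun r : ℚ => (C (C r) : ℚ[X][X])) h1
        simpa only [map_mul, map_intCast, map_natCast] using h2
      rw [toPoly]
      simp only [ev_cons, ev_nil, hq, map_mul, map_pow]
      push_cast
      ring

/-! ### Certificates that a polynomial annihilates a combination of two algebraic numbers -/

/-- The data `e`, `U`, `V` certify that `P` vanishes at `s(α, β)` whenever `p` vanishes at `α` and
`q` vanishes at `β`: the identity `P(s) ^ e + U p(x) + V q(y) = 0` holds. -/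
def Annihilates (s : BiList) (p q P : List ℤ) (e : ℕ) (U V : BiList) : Prop :=
  IsZero (pow (subst s P) e ++ (mul U (subst [(1, 1, 0)] p) ++ mul V (subst [(1, 0, 1)] q)))

lemma Annihilates.aeval_eq_zero {s : BiList} {p q P : List ℤ} {e : ℕ} {U V : BiList}
    (h : Annihilates s p q P e U V) {α β : ℂ} (hα : aeval α (polyOfList p) = 0)
    (hβ : aeval β (polyOfList q) = 0) : aeval (ev α β s) (polyOfList P) = 0 := by
  have := h.ev_eq_zero α β
  simp only [ev_append, ev_pow, ev_mul, ev_subst, ev_cons, ev_nil] at this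
  simp only [pow_one, pow_zero, mul_one, Int.cast_one, one_mul, add_zero, hα, hβ, mul_zero] at this
  exact eq_zero_of_pow_eq_zero this

/-- An integer combination `s` of two algebraic elements is algebraic: some power of a separable
polynomial in `s` lies in the ideal generated by the polynomials of the two elements. -/
lemma exists_separable_pow_eq {S : Type*} [CommRing S] [Algebra ℚ S] (x y : S) (s : BiList)
    {p q : List ℤ} (hp : polyOfList p ≠ 0) (hq : polyOfList q ≠ 0) :
    ∃ R : ℚ[X], R.Separable ∧ ∃ (e : ℕ) (A B : S), aeval (ev x y s) R ^ (e + 1)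
      = A * aeval x (polyOfList p) + B * aeval y (polyOfList q) := by
  -- Modulo this ideal `x` and `y` are integral over ℚ, hence so is their combination, and a monic
  -- `T` sends it into the ideal. Passing to the radical of `T` gives separability in characteristic
  -- zero, at the price of a power, since `T` divides only a power of its radical.
  let I : Ideal S := Ideal.span {aeval x (polyOfList p), aeval y (polyOfList q)}
  let π : S →ₐ[ℚ] S ⧸ I := Ideal.Quotient.mkₐ ℚ I
  have hint : ∀ (z : S) (l : List ℤ), polyOfList l ≠ 0 → aeval z (polyOfList l) ∈ I →
      IsIntegral ℚ (π z) := by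
    intro z l hl hz
    refine isAlgebraic_iff_isIntegral.1 ⟨(polyOfList l).map (algebraMap ℤ ℚ),
      (Polynomial.map_ne_zero_iff (algebraMap ℤ ℚ).injective_int).2 hl, ?_⟩
    rw [aeval_map_algebraMap]
    have h1 : aeval (π z) (polyOfList l) = π (aeval z (polyOfList l)) :=
      aeval_algHom_apply (π.restrictScalars ℤ) z _
    rw [h1]
    exact Ideal.Quotient.eq_zero_iff_mem.2 hz
  have hx : IsIntegral ℚ (π x) := hint x p hp (Ideal.subset_span (by simp))
  have hy : IsIntegral ℚ (π y) := hint y q hq (Ideal.subset_span (by simp))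
  obtain ⟨T, hT, hTs⟩ : IsIntegral ℚ (π (ev x y s)) := by
    have h := map_ev (π : S →+* S ⧸ I) x y s
    rw [RingHom.coe_coe] at h
    rw [h]
    exact isIntegral_ev hx hy s
  have hTmem : aeval (ev x y s) T ∈ I := by
    rw [← Ideal.Quotient.eq_zero_iff_mem]
    change π (aeval (ev x y s) T) = 0
    rw [← aeval_algHom_apply]
    exact hTs
  have hT0 : T ≠ 0 := hT.ne_zero
  obtain ⟨e, W, hW⟩ := UniqueFactorizationMonoid.exists_dvd_radical_self_pow hT0
  refine ⟨UniqueFactorizationMonoid.radical T,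
    PerfectField.separable_iff_squarefree.2 UniqueFactorizationMonoid.squarefree_radical, e, ?_⟩
  have hmem : aeval (ev x y s) (UniqueFactorizationMonoid.radical T) ^ (e + 1) ∈ I := by
    rw [← map_pow, pow_succ', hW, mul_left_comm, map_mul]
    exact I.mul_mem_right _ hTmem
  obtain ⟨A, B, hAB⟩ := Ideal.mem_span_pair.1 hmem
  exact ⟨A, B, hAB.symm⟩

/-- Up to a nonzero integer factor every rational polynomial is given by an integer list. -/
lemma exists_polyOfList_eq_C_mul (R : ℚ[X]) : ∃ N : ℤ, N ≠ 0 ∧ ∃ l : List ℤ,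
    (polyOfList l).map (algebraMap ℤ ℚ) = C (N : ℚ) * R := by
  obtain ⟨N, hN, hR⟩ := IsLocalization.integerNormalization_spec (nonZeroDivisors ℤ) R
  obtain ⟨l, hl⟩ := exists_polyOfList (IsLocalization.integerNormalization (nonZeroDivisors ℤ) R)
  refine ⟨N, nonZeroDivisors.ne_zero hN, l, ?_⟩
  rw [hl, hR]
  ext n
  simp

/-- Completeness of the algebraic part of a certificate. The preceding construction is applied to
the two variables of ℚ[X][X], and denominators are cleared. Simplicity of the roots of `P` is what
later makes the injectivity test succeed on small discs. -/
lemma exists_annihilates (s : BiList) {p q : List ℤ} (hp : polyOfList p ≠ 0)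
    (hq : polyOfList q ≠ 0) : ∃ (P : List ℤ) (e : ℕ) (U V : BiList), Annihilates s p q P e U V ∧
      ∀ γ : ℂ, aeval γ (polyOfList P) = 0 → aeval γ (derivative (polyOfList P)) ≠ 0 := by
  obtain ⟨R, hsep, e, A, B, hAB⟩ := exists_separable_pow_eq (C X : ℚ[X][X]) X s hp hq
  -- The multipliers `A` and `B` have rational coefficients, only `N₁ A` and `N₂ B` being given by
  -- lists. Putting `N₁ * N₂` into `P` repairs this: in the exponent `e + 1` there is at least one
  -- factor `N₁ * N₂ * N₃`, of which `N₁` is spent on `A` and `N₂` on `B`.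
  obtain ⟨N₁, hN₁, U, hU⟩ := exists_toPoly_eq_intCast_mul A
  obtain ⟨N₂, hN₂, V, hV⟩ := exists_toPoly_eq_intCast_mul B
  obtain ⟨N₃, hN₃, P, hP⟩ := exists_polyOfList_eq_C_mul (C ((N₁ * N₂ : ℤ) : ℚ) * R)
  have hPR : (polyOfList P).map (algebraMap ℤ ℚ) = C ((N₁ * N₂ * N₃ : ℤ) : ℚ) * R := by
    rw [hP, ← mul_assoc, ← C_mul]
    push_cast
    ring_nf
  have hev : ∀ {A : Type} [CommRing A] [Algebra ℚ A] (z : A),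
      aeval z (polyOfList P) = ((N₁ * N₂ * N₃ : ℤ) : A) * aeval z R := by
    intro A _ _ z
    rw [← aeval_map_algebraMap ℚ, hPR, map_mul, aeval_C, map_intCast]
  have hdev : ∀ z : ℂ, aeval z (derivative (polyOfList P))
      = ((N₁ * N₂ * N₃ : ℤ) : ℂ) * aeval z (derivative R) := by
    intro z
    rw [← aeval_map_algebraMap ℚ, ← derivative_map, hPR, derivative_C_mul, map_mul, aeval_C,
      map_intCast]
  have hN : ((N₁ * N₂ * N₃ : ℤ) : ℂ) ≠ 0 := by
    exact_mod_cast mul_ne_zero (mul_ne_zero hN₁ hN₂) hN₃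
  refine ⟨P, e + 1, mul [(-((N₁ * N₂ * N₃) ^ e * N₂ * N₃), 0, 0)] U,
    mul [(-((N₁ * N₂ * N₃) ^ e * N₁ * N₃), 0, 0)] V, ?_, fun γ hγ => ?_⟩
  · rw [Annihilates, isZero_iff]
    rw [toPoly] at hU hV ⊢
    simp only [ev_append, ev_pow, ev_mul, ev_subst, ev_cons, ev_nil, hU, hV]
    rw [hev, mul_pow, hAB]
    simp only [pow_one, pow_zero, mul_one, Int.cast_one, one_mul, add_zero]
    push_cast
    ring
  · rw [hev, mul_eq_zero, or_iff_right hN] at hγ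
    rw [hdev]
    exact mul_ne_zero hN (hsep.aeval_derivative_ne_zero hγ)

end BiList

/-! ### Primitive recursiveness of the operations on dyadic Gaussian rationals -/

namespace GDyadic

lemma primrec_add : Primrec₂ add := by
  have a₁ : Primrec fun p : GDyadic × GDyadic => p.1.1 := Primrec.fst.comp Primrec.fst
  have b₁ : Primrec fun p : GDyadic × GDyadic => p.1.2.1 :=
    Primrec.fst.comp (Primrec.snd.comp Primrec.fst)
  have k₁ : Primrec fun p : GDyadic × GDyadic => p.1.2.2 :=
    Primrec.snd.comp (Primrec.snd.comp Primrec.fst)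
  have a₂ : Primrec fun p : GDyadic × GDyadic => p.2.1 := Primrec.fst.comp Primrec.snd
  have b₂ : Primrec fun p : GDyadic × GDyadic => p.2.2.1 :=
    Primrec.fst.comp (Primrec.snd.comp Primrec.snd)
  have k₂ : Primrec fun p : GDyadic × GDyadic => p.2.2.2 :=
    Primrec.snd.comp (Primrec.snd.comp Primrec.snd)
  have e₁ := Primrec.int_natCast.comp (Primrec.nat_pow.comp (Primrec.const 2) k₁)
  have e₂ := Primrec.int_natCast.comp (Primrec.nat_pow.comp (Primrec.const 2) k₂)
  exact (Primrec.int_add.comp (Primrec.int_mul.comp a₁ e₂) (Primrec.int_mul.comp a₂ e₁)).pair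
    ((Primrec.int_add.comp (Primrec.int_mul.comp b₁ e₂) (Primrec.int_mul.comp b₂ e₁)).pair
      (Primrec.nat_add.comp k₁ k₂))

lemma primrec_neg : Primrec neg :=
  (Primrec.int_neg.comp Primrec.fst).pair
    ((Primrec.int_neg.comp (Primrec.fst.comp Primrec.snd)).pair (Primrec.snd.comp Primrec.snd))

lemma primrec_mul : Primrec₂ mul := by
  have a₁ : Primrec fun p : GDyadic × GDyadic => p.1.1 := Primrec.fst.comp Primrec.fst
  have b₁ : Primrec fun p : GDyadic × GDyadic => p.1.2.1 :=
    Primrec.fst.comp (Primrec.snd.comp Primrec.fst)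
  have k₁ : Primrec fun p : GDyadic × GDyadic => p.1.2.2 :=
    Primrec.snd.comp (Primrec.snd.comp Primrec.fst)
  have a₂ : Primrec fun p : GDyadic × GDyadic => p.2.1 := Primrec.fst.comp Primrec.snd
  have b₂ : Primrec fun p : GDyadic × GDyadic => p.2.2.1 :=
    Primrec.fst.comp (Primrec.snd.comp Primrec.snd)
  have k₂ : Primrec fun p : GDyadic × GDyadic => p.2.2.2 :=
    Primrec.snd.comp (Primrec.snd.comp Primrec.snd)
  exact (Primrec.int_add.comp (Primrec.int_mul.comp a₁ a₂)
      (Primrec.int_neg.comp (Primrec.int_mul.comp b₁ b₂))).pair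
    ((Primrec.int_add.comp (Primrec.int_mul.comp a₁ b₂) (Primrec.int_mul.comp b₁ a₂)).pair
      (Primrec.nat_add.comp k₁ k₂))

lemma primrec_invPow : Primrec invPow :=
  (Primrec.const 1).pair ((Primrec.const 0).pair Primrec.id)

lemma primrec_normLt : PrimrecRel NormLt := by
  have hn : Primrec fun z : GDyadic =>
      z.1.natAbs * z.1.natAbs + z.2.1.natAbs * z.2.1.natAbs := by
    have a := Primrec.int_natAbs.comp (Primrec.fst (α := ℤ) (β := ℤ × ℕ))
    have b := Primrec.int_natAbs.comp
      ((Primrec.fst (α := ℤ) (β := ℕ)).comp (Primrec.snd (α := ℤ) (β := ℤ × ℕ)))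
    exact Primrec.nat_add.comp (Primrec.nat_mul.comp a a) (Primrec.nat_mul.comp b b)
  have hk : Primrec fun z : GDyadic => 4 ^ z.2.2 :=
    Primrec.nat_pow.comp (Primrec.const 4) (Primrec.snd.comp Primrec.snd)
  exact Primrec.nat_lt.comp
    (Primrec.nat_mul.comp (hn.comp Primrec.fst) (hk.comp Primrec.snd))
    (Primrec.nat_mul.comp (hn.comp Primrec.snd) (hk.comp Primrec.fst))

lemma primrec_evalDeriv : Primrec₂ evalDeriv := by
  refine Primrec.list_foldr (f := fun p : GDyadic × List ℤ => p.2)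
    (h := fun p (q : ℤ × GDyadic × GDyadic) =>
      (add (q.1, 0, 0) (mul p.1 q.2.1), add q.2.1 (mul p.1 q.2.2)))
    Primrec.snd (Primrec.const ((0, 0, 0), (0, 0, 0))) ?_
  have z : Primrec fun p : (GDyadic × List ℤ) × ℤ × GDyadic × GDyadic => p.1.1 :=
    Primrec.fst.comp Primrec.fst
  have a : Primrec fun p : (GDyadic × List ℤ) × ℤ × GDyadic × GDyadic => p.2.1 :=
    Primrec.fst.comp Primrec.snd
  have v : Primrec fun p : (GDyadic × List ℤ) × ℤ × GDyadic × GDyadic => p.2.2.1 :=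
    Primrec.fst.comp (Primrec.snd.comp Primrec.snd)
  have d : Primrec fun p : (GDyadic × List ℤ) × ℤ × GDyadic × GDyadic => p.2.2.2 :=
    Primrec.snd.comp (Primrec.snd.comp Primrec.snd)
  exact (primrec_add.comp (a.pair (Primrec.const (0, 0))) (primrec_mul.comp z v)).pair
    (primrec_add.comp v (primrec_mul.comp z d))

end GDyadic

lemma primrec_growthBound : Primrec₂ growthBound := by
  refine Primrec.list_foldr (f := fun p : ℕ × List ℤ => p.2)
    (h := fun p (q : ℤ × ℕ × ℕ × ℕ) => (q.1.natAbs + p.1 * q.2.1, q.2.1 + p.1 * q.2.2.1,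
      2 * q.2.2.1 + p.1 * q.2.2.2)) Primrec.snd (Primrec.const (0, 0, 0)) ?_
  have M : Primrec fun p : (ℕ × List ℤ) × ℤ × ℕ × ℕ × ℕ => p.1.1 := Primrec.fst.comp Primrec.fst
  have a : Primrec fun p : (ℕ × List ℤ) × ℤ × ℕ × ℕ × ℕ => p.2.1 := Primrec.fst.comp Primrec.snd
  have s : Primrec fun p : (ℕ × List ℤ) × ℤ × ℕ × ℕ × ℕ => p.2.2 := Primrec.snd.comp Primrec.snd
  have s₁ := Primrec.fst.comp s
  have s₂ := Primrec.fst.comp (Primrec.snd.comp s)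
  have s₃ := Primrec.snd.comp (Primrec.snd.comp s)
  exact (Primrec.nat_add.comp (Primrec.int_natAbs.comp a) (Primrec.nat_mul.comp M s₁)).pair
    ((Primrec.nat_add.comp s₁ (Primrec.nat_mul.comp M s₂)).pair
      (Primrec.nat_add.comp (Primrec.nat_mul.comp (Primrec.const 2) s₂)
        (Primrec.nat_mul.comp M s₃)))

/-! ### Primitive recursiveness of the operations on lists of monomials -/

namespace BiList

lemma primrec_mul : Primrec₂ mul := by
  refine Primrec.list_flatMap Primrec.fst ?_
  refine Primrec.list_map (Primrec.snd.comp Primrec.fst) ?_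
  have t : Primrec fun p : ((BiList × BiList) × ℤ × ℕ × ℕ) × ℤ × ℕ × ℕ => p.1.2 :=
    Primrec.snd.comp Primrec.fst
  have u : Primrec fun p : ((BiList × BiList) × ℤ × ℕ × ℕ) × ℤ × ℕ × ℕ => p.2 := Primrec.snd
  exact (Primrec.int_mul.comp (Primrec.fst.comp t) (Primrec.fst.comp u)).pair
    ((Primrec.nat_add.comp (Primrec.fst.comp (Primrec.snd.comp t))
      (Primrec.fst.comp (Primrec.snd.comp u))).pair
    (Primrec.nat_add.comp (Primrec.snd.comp (Primrec.snd.comp t))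
      (Primrec.snd.comp (Primrec.snd.comp u))))

lemma primrec_pow : Primrec₂ pow :=
  Primrec.nat_iterate Primrec.snd (Primrec.const _)
    (primrec_mul.comp (Primrec.fst.comp Primrec.fst) Primrec.snd)

lemma primrec_subst : Primrec₂ subst := by
  refine Primrec.list_foldr (f := fun p : BiList × List ℤ => p.2)
    (h := fun p (q : ℤ × BiList) => (q.1, 0, 0) :: mul p.1 q.2)
    Primrec.snd (Primrec.const []) ?_
  exact Primrec.list_cons.comp ((Primrec.fst.comp Primrec.snd).pair (Primrec.const (0, 0)))
    (primrec_mul.comp (Primrec.fst.comp Primrec.fst) (Primrec.snd.comp Primrec.snd))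

lemma primrec_coeffSum : Primrec₂ coeffSum := by
  refine Primrec.list_foldr (f := fun p : BiList × ℕ × ℕ => p.1)
    (h := fun p (q : (ℤ × ℕ × ℕ) × ℤ) => if q.1.2 = p.2 then q.1.1 + q.2 else q.2)
    Primrec.fst (Primrec.const 0) ?_
  have t : Primrec fun p : (BiList × ℕ × ℕ) × (ℤ × ℕ × ℕ) × ℤ => p.2.1 :=
    Primrec.fst.comp Primrec.snd
  have c : Primrec fun p : (BiList × ℕ × ℕ) × (ℤ × ℕ × ℕ) × ℤ => p.2.2 :=
    Primrec.snd.comp Primrec.snd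
  exact Primrec.ite (Primrec.eq.comp (Primrec.snd.comp t) (Primrec.snd.comp Primrec.fst))
    (Primrec.int_add.comp (Primrec.fst.comp t) c) c

lemma primrec_isZero : PrimrecPred IsZero := by
  have h : PrimrecRel fun (t : ℤ × ℕ × ℕ) (l : BiList) => coeffSum l t.2 = 0 :=
    Primrec.eq.comp (primrec_coeffSum.comp Primrec.snd (Primrec.snd.comp Primrec.fst))
      (Primrec.const 0)
  exact (PrimrecRel.forall_mem_list h).comp Primrec.id Primrec.id

end BiList

/-! ### Approximating an algebraic number given by a code -/

namespace AlgCode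

open GDyadic

/-- The value of the polynomial of `c` at `z` is so small that the number named by `c` is within
`2 ^ (-k)` of `z`. -/
def IsApprox (c : AlgCode) (z : GDyadic) (k : ℕ) : Prop :=
  NormLt (evalDeriv z c.1).1 (invPow (k * c.1.length)) ∧ c.2.2.2 < k ∧
    NormLt (add z (neg c.2)) (add (invPow c.2.2.2) (neg (invPow k)))

/-- The derivative of the polynomial of `c` is so large at the centre of the disc of `c` that the
polynomial is injective on this disc. -/
def IsInjective (c : AlgCode) (m : ℕ) : Prop :=
  NormLt c.2 ((2 ^ m : ℕ), 0, 0) ∧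
    NormLt (((growthBound (2 ^ m + 1) c.1).2.2 : ℤ), 0, c.2.2.2) (evalDeriv c.2 c.1).2

lemma norm_val_natCast (n k : ℕ) : ‖val ((n : ℤ), 0, k)‖ = n / 2 ^ k := by
  simp [val]

lemma names_iff (c : AlgCode) (α : ℂ) : c.Names α ↔ polyOfList c.1 ≠ 0 ∧
    ∀ z : ℂ, (aeval z (polyOfList c.1) = 0 ∧ ‖z - val c.2‖ < 1 / 2 ^ c.2.2.2) ↔ z = α := Iff.rfl

lemma Names.aeval_eq_zero {c : AlgCode} {α : ℂ} (h : c.Names α) :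
    aeval α (polyOfList c.1) = 0 := ((h.2 α).2 rfl).1

lemma Names.norm_sub_lt {c : AlgCode} {α : ℂ} (h : c.Names α) :
    ‖α - val c.2‖ < 1 / 2 ^ c.2.2.2 := ((h.2 α).2 rfl).2

lemma norm_invPow_sub {j k : ℕ} (h : j < k) :
    ‖val (add (invPow j) (neg (invPow k)))‖ = 1 / 2 ^ j - 1 / 2 ^ k := by
  rw [val_add, val_neg, val_invPow, val_invPow]
  have h1 : (1 / 2 ^ j + -(1 / 2 ^ k) : ℂ) = ((1 / 2 ^ j - 1 / 2 ^ k : ℝ) : ℂ) := by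
    push_cast; ring
  rw [h1, Complex.norm_real, Real.norm_of_nonneg]
  exact sub_nonneg.2 (one_div_le_one_div_of_le (by positivity)
    (pow_le_pow_right₀ (by norm_num) h.le))

lemma isApprox_iff (c : AlgCode) (z : GDyadic) (k : ℕ) : c.IsApprox z k ↔
    ‖aeval z.val (polyOfList c.1)‖ < (1 / 2 ^ k : ℝ) ^ c.1.length ∧ c.2.2.2 < k ∧
      ‖z.val - val c.2‖ < 1 / 2 ^ c.2.2.2 - 1 / 2 ^ k := by
  have h1 : ‖val (invPow (k * c.1.length))‖ = (1 / 2 ^ k : ℝ) ^ c.1.length := by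
    rw [val_invPow]
    simp [pow_mul]
  rw [IsApprox, normLt_iff, normLt_iff, val_evalDeriv_fst, h1]
  refine and_congr_right fun _ => and_congr_right fun hk => ?_
  rw [norm_invPow_sub hk, val_add, val_neg, ← sub_eq_add_neg]

/-- Smallness of the polynomial yields a root within 2^(-k) of `z`; the last clause of `IsApprox`
keeps that root inside the disc of `c`, where `α` is the only one. -/
lemma Names.norm_sub_lt_of_isApprox {c : AlgCode} {α : ℂ} (h : c.Names α) {z : GDyadic} {k : ℕ}
    (hz : c.IsApprox z k) : ‖α - z.val‖ < 1 / 2 ^ k := by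
  obtain ⟨h1, hk, h2⟩ := (isApprox_iff c z k).1 hz
  obtain ⟨w, hw, hwz⟩ := exists_root_near c.1 h.1 z.val (r := 1 / 2 ^ k) (by positivity)
    ((div_le_one (by positivity)).2 (one_le_pow₀ (by norm_num))) h1
  have : w = α := by
    refine (h.2 w).1 ⟨hw, ?_⟩
    change ‖w - val c.2‖ < _
    calc ‖w - val c.2‖ ≤ ‖w - z.val‖ + ‖z.val - val c.2‖ := norm_sub_le_norm_sub_add_norm_sub _ _ _
      _ < _ := by linarith
  rwa [← this]

lemma tendsto_one_div_two_pow : Tendsto (fun k : ℕ => (1 : ℝ) / 2 ^ k) atTop (𝓝 0) := by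
  simpa using tendsto_pow_atTop_nhds_zero_of_lt_one (r := (2 : ℝ)⁻¹) (by norm_num) (by norm_num)

lemma exists_gdyadic_mem_nhds {α : ℂ} {s : Set ℂ} (hs : s ∈ 𝓝 α) : ∃ z : GDyadic, z.val ∈ s := by
  obtain ⟨ε, hε, hball⟩ := Metric.mem_nhds_iff.1 hs
  obtain ⟨K, hK⟩ := (tendsto_one_div_two_pow.eventually_lt_const hε).exists
  obtain ⟨a, b, hab⟩ := exists_close α K
  refine ⟨(a, b, K), hball ?_⟩
  rw [mem_ball_iff_norm, norm_sub_rev]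
  have : (0 : ℝ) < 1 / 2 ^ K := by positivity
  linarith

/-- Once 2^(-k) is smaller than the gap between `α` and the boundary of the disc, the conditions
hold at `α` and are open in `z`, so some dyadic point satisfies them. -/
lemma Names.eventually_exists_isApprox {c : AlgCode} {α : ℂ} (h : c.Names α) :
    ∀ᶠ k in atTop, ∃ z, c.IsApprox z k := by
  have hd : 0 < 1 / 2 ^ c.2.2.2 - ‖α - val c.2‖ := sub_pos.2 h.norm_sub_lt
  filter_upwards [eventually_gt_atTop c.2.2.2, tendsto_one_div_two_pow.eventually_lt_const hd]
    with k hk hkd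
  have h1 : ∀ᶠ z in 𝓝 α, ‖aeval z (polyOfList c.1)‖ < (1 / 2 ^ k : ℝ) ^ c.1.length := by
    have hc : Continuous fun z : ℂ => ‖aeval z (polyOfList c.1)‖ :=
      (Polynomial.continuous_aeval _).norm
    refine hc.continuousAt.eventually_lt continuousAt_const ?_
    rw [h.aeval_eq_zero, norm_zero]
    positivity
  have h2 : ∀ᶠ z in 𝓝 α, ‖z - val c.2‖ < 1 / 2 ^ c.2.2.2 - 1 / 2 ^ k := by
    have hc : Continuous fun z : ℂ => ‖z - val c.2‖ := by fun_prop
    refine hc.continuousAt.eventually_lt continuousAt_const ?_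
    linarith
  obtain ⟨z, hz1, hz2⟩ := exists_gdyadic_mem_nhds (h1.and h2)
  exact ⟨z, (isApprox_iff c z k).2 ⟨hz1, hk, hz2⟩⟩

lemma isInjective_iff (c : AlgCode) (m : ℕ) : c.IsInjective m ↔ ‖val c.2‖ < 2 ^ m ∧
    (growthBound (2 ^ m + 1) c.1).2.2 * (1 / 2 ^ c.2.2.2 : ℝ)
      < ‖aeval (val c.2) (derivative (polyOfList c.1))‖ := by
  rw [IsInjective, normLt_iff, normLt_iff, norm_val_natCast, norm_val_natCast, val_evalDeriv_snd,
    mul_one_div]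
  simp

lemma names_of_isInjective {c : AlgCode} {m : ℕ} (h : c.IsInjective m) {γ : ℂ}
    (hγ : aeval γ (polyOfList c.1) = 0) (hd : ‖γ - val c.2‖ < 1 / 2 ^ c.2.2.2) : c.Names γ := by
  obtain ⟨h1, h2⟩ := (isInjective_iff c m).1 h
  have hr : (1 : ℝ) / 2 ^ c.2.2.2 ≤ 1 :=
    (div_le_one (by positivity)).2 (one_le_pow₀ (by norm_num))
  have hM : ∀ z : ℂ, ‖z - val c.2‖ < 1 / 2 ^ c.2.2.2 → ‖z‖ ≤ ((2 ^ m + 1 : ℕ) : ℝ) := by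
    intro z hz
    have := norm_sub_norm_le z (val c.2)
    push_cast
    linarith
  refine (names_iff c γ).2 ⟨fun h0 => ?_, fun z => ⟨fun hz => ?_, ?_⟩⟩
  -- The strict lower bound on the derivative excludes the zero polynomial.
  · rw [h0] at h2
    simp only [map_zero, norm_zero] at h2
    exact absurd h2 (not_lt.2 (by positivity))
  · exact eq_of_roots_of_growthBound_lt (hM z hz.2) (hM γ hd)
      (by push_cast; linarith) hz.2.le hd.le h2 hz.1 hγ
  · rintro rfl
    exact ⟨hγ, hd⟩

lemma primrec_isApprox :
    PrimrecPred fun p : AlgCode × GDyadic × ℕ => p.1.IsApprox p.2.1 p.2.2 := by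
  have l : Primrec fun p : AlgCode × GDyadic × ℕ => p.1.1 := Primrec.fst.comp Primrec.fst
  have d : Primrec fun p : AlgCode × GDyadic × ℕ => p.1.2 := Primrec.snd.comp Primrec.fst
  have r : Primrec fun p : AlgCode × GDyadic × ℕ => p.1.2.2.2 :=
    Primrec.snd.comp (Primrec.snd.comp d)
  have z : Primrec fun p : AlgCode × GDyadic × ℕ => p.2.1 := Primrec.fst.comp Primrec.snd
  have k : Primrec fun p : AlgCode × GDyadic × ℕ => p.2.2 := Primrec.snd.comp Primrec.snd
  refine PrimrecPred.and ?_ (PrimrecPred.and (Primrec.nat_lt.comp r k) ?_)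
  · exact primrec_normLt.comp (Primrec.fst.comp (primrec_evalDeriv.comp z l))
      (primrec_invPow.comp (Primrec.nat_mul.comp k (Primrec.list_length.comp l)))
  · exact primrec_normLt.comp (primrec_add.comp z (primrec_neg.comp d))
      (primrec_add.comp (primrec_invPow.comp r) (primrec_neg.comp (primrec_invPow.comp k)))

lemma primrec_natGDyadic : Primrec fun m : ℕ => ((((2 ^ m : ℕ) : ℤ), 0, 0) : GDyadic) :=
  (Primrec.int_natCast.comp (Primrec.nat_pow.comp (Primrec.const 2) Primrec.id)).pair
    (Primrec.const (0, 0))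

lemma primrec_isInjective : PrimrecRel IsInjective := by
  have l : Primrec fun p : AlgCode × ℕ => p.1.1 := Primrec.fst.comp Primrec.fst
  have d : Primrec fun p : AlgCode × ℕ => p.1.2 := Primrec.snd.comp Primrec.fst
  have r : Primrec fun p : AlgCode × ℕ => p.1.2.2.2 := Primrec.snd.comp (Primrec.snd.comp d)
  have m : Primrec fun p : AlgCode × ℕ => p.2 := Primrec.snd
  refine PrimrecPred.and (primrec_normLt.comp d (primrec_natGDyadic.comp m)) ?_
  refine primrec_normLt.comp (Primrec.pair (Primrec.int_natCast.comp ?_)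
    ((Primrec.const 0).pair r)) (Primrec.snd.comp (primrec_evalDeriv.comp d l))
  exact Primrec.snd.comp (Primrec.snd.comp (primrec_growthBound.comp
    (Primrec.succ.comp (Primrec.nat_pow.comp (Primrec.const 2) m)) l))

/-! ### Arithmetic on codes -/

/-- The data of a certificate that a code names `s(α, β)`: the code, an exponent and two lists of
monomials that prove that its polynomial vanishes at `s(α, β)`, approximations of `α` and `β` and
their precision, and a bound on the absolute values. -/
abbrev Certificate : Type := AlgCode × (ℕ × BiList × BiList) × (GDyadic × GDyadic) × ℕ × ℕ

/-- Validity of a certificate. -/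
def IsCertificate (s : BiList) (f : GDyadic → GDyadic → GDyadic) (c : AlgCode × AlgCode)
    (w : Certificate) : Prop :=
  BiList.Annihilates s c.1.1 c.2.1 w.1.1 w.2.1.1 w.2.1.2.1 w.2.1.2.2 ∧
  w.1.IsInjective w.2.2.2.2 ∧
  (c.1.IsApprox w.2.2.1.1 w.2.2.2.1 ∧ NormLt w.2.2.1.1 ((2 ^ w.2.2.2.2 : ℕ), 0, 0)) ∧
  (c.2.IsApprox w.2.2.1.2 w.2.2.2.1 ∧ NormLt w.2.2.1.2 ((2 ^ w.2.2.2.2 : ℕ), 0, 0)) ∧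
  w.2.2.2.2 + w.1.2.2.2 + 4 ≤ w.2.2.2.1 ∧
  NormLt (mul (4, 0, 0) (add (f w.2.2.1.1 w.2.2.1.2) (neg w.1.2))) (3, 0, w.1.2.2.2)

lemma primrec_isCertificate (s : BiList) {f : GDyadic → GDyadic → GDyadic} (hf : Primrec₂ f) :
    PrimrecRel (IsCertificate s f) := by
  have w : Primrec fun p : (AlgCode × AlgCode) × Certificate => p.2 := Primrec.snd
  have l₁ : Primrec fun p : (AlgCode × AlgCode) × Certificate => p.1.1.1 :=
    Primrec.fst.comp (Primrec.fst.comp Primrec.fst)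
  have l₂ : Primrec fun p : (AlgCode × AlgCode) × Certificate => p.1.2.1 :=
    Primrec.fst.comp (Primrec.snd.comp Primrec.fst)
  have c₃ : Primrec fun p : (AlgCode × AlgCode) × Certificate => p.2.1 := Primrec.fst.comp w
  have w₁ : Primrec fun p : (AlgCode × AlgCode) × Certificate => p.2.2.1 :=
    Primrec.fst.comp (Primrec.snd.comp w)
  have w₂ : Primrec fun p : (AlgCode × AlgCode) × Certificate => p.2.2.2 :=
    Primrec.snd.comp (Primrec.snd.comp w)
  have z₁ : Primrec fun p : (AlgCode × AlgCode) × Certificate => p.2.2.2.1.1 :=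
    Primrec.fst.comp (Primrec.fst.comp w₂)
  have z₂ : Primrec fun p : (AlgCode × AlgCode) × Certificate => p.2.2.2.1.2 :=
    Primrec.snd.comp (Primrec.fst.comp w₂)
  have k : Primrec fun p : (AlgCode × AlgCode) × Certificate => p.2.2.2.2.1 :=
    Primrec.fst.comp (Primrec.snd.comp w₂)
  have m : Primrec fun p : (AlgCode × AlgCode) × Certificate => p.2.2.2.2.2 :=
    Primrec.snd.comp (Primrec.snd.comp w₂)
  have d : Primrec fun p : (AlgCode × AlgCode) × Certificate => p.2.1.2 := Primrec.snd.comp c₃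
  have r : Primrec fun p : (AlgCode × AlgCode) × Certificate => p.2.1.2.2.2 :=
    Primrec.snd.comp (Primrec.snd.comp d)
  have hann : PrimrecPred fun p : (AlgCode × AlgCode) × Certificate =>
      BiList.Annihilates s p.1.1.1 p.1.2.1 p.2.1.1 p.2.2.1.1 p.2.2.1.2.1 p.2.2.1.2.2 := by
    refine BiList.primrec_isZero.comp (Primrec.list_append.comp
      (BiList.primrec_pow.comp (BiList.primrec_subst.comp (Primrec.const s) (Primrec.fst.comp c₃))
        (Primrec.fst.comp w₁)) (Primrec.list_append.comp ?_ ?_))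
    · exact BiList.primrec_mul.comp (Primrec.fst.comp (Primrec.snd.comp w₁))
        (BiList.primrec_subst.comp (Primrec.const _) l₁)
    · exact BiList.primrec_mul.comp (Primrec.snd.comp (Primrec.snd.comp w₁))
        (BiList.primrec_subst.comp (Primrec.const _) l₂)
  have hz₁ := primrec_isApprox.comp ((Primrec.fst.comp Primrec.fst).pair (z₁.pair k))
  have hz₂ := primrec_isApprox.comp ((Primrec.snd.comp Primrec.fst).pair (z₂.pair k))
  have hM := primrec_natGDyadic.comp m
  have hk : PrimrecPred fun p : (AlgCode × AlgCode) × Certificate =>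
      p.2.2.2.2.2 + p.2.1.2.2.2 + 4 ≤ p.2.2.2.2.1 :=
    Primrec.nat_le.comp (Primrec.nat_add.comp (Primrec.nat_add.comp m r) (Primrec.const 4)) k
  have hclose : PrimrecPred fun p : (AlgCode × AlgCode) × Certificate =>
      NormLt (mul (4, 0, 0) (add (f p.2.2.2.1.1 p.2.2.2.1.2) (neg p.2.1.2)))
        (3, 0, p.2.1.2.2.2) :=
    primrec_normLt.comp (primrec_mul.comp (Primrec.const (4, 0, 0))
      (primrec_add.comp (hf.comp z₁ z₂) (primrec_neg.comp d)))
      ((Primrec.const 3).pair ((Primrec.const 0).pair r))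
  exact hann.and ((primrec_isInjective.comp c₃ m).and ((hz₁.and (primrec_normLt.comp z₁ hM)).and
    ((hz₂.and (primrec_normLt.comp z₂ hM)).and (hk.and hclose))))

/-- The polynomial `s` is computed by `f` on dyadic Gaussian rationals, and it is Lipschitz with
constant `2 ^ (m + 2)` near points of absolute value at most `2 ^ m`. -/
structure IsLipschitzOp (s : BiList) (f : GDyadic → GDyadic → GDyadic) : Prop where
  primrec : Primrec₂ f
  val_eq : ∀ z w, (f z w).val = BiList.ev z.val w.val s
  norm_sub_le : ∀ (m : ℕ) (r : ℝ) (α β z w : ℂ), r ≤ 1 → ‖z‖ ≤ 2 ^ m → ‖w‖ ≤ 2 ^ m →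
    ‖α - z‖ ≤ r → ‖β - w‖ ≤ r → ‖BiList.ev α β s - BiList.ev z w s‖ ≤ 2 ^ (m + 2) * r

variable {s : BiList} {f : GDyadic → GDyadic → GDyadic}

lemma one_div_two_pow_le_one (k : ℕ) : (1 : ℝ) / 2 ^ k ≤ 1 :=
  (div_le_one (by positivity)).2 (one_le_pow₀ (by norm_num))

lemma two_pow_mul_one_div_le {j k l : ℕ} (h : j + l ≤ k) :
    (2 : ℝ) ^ j * (1 / 2 ^ k) ≤ 1 / 2 ^ l := by
  rw [mul_one_div, div_le_div_iff₀ (by positivity) (by positivity), one_mul, ← pow_add]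
  exact pow_le_pow_right₀ (by norm_num) h

lemma normLt_four_mul_iff (z d : GDyadic) : NormLt (mul (4, 0, 0) (add z (neg d))) (3, 0, d.2.2) ↔
    ‖z.val - d.val‖ < 3 / 4 * (1 / 2 ^ d.2.2) := by
  have h1 : ‖val (3, 0, d.2.2)‖ = 3 / 2 ^ d.2.2 := norm_val_natCast 3 d.2.2
  have h2 : ‖val (4, 0, 0)‖ = 4 := by simp [val]
  rw [normLt_iff, h1, val_mul, norm_mul, h2, val_add, val_neg, ← sub_eq_add_neg,
    show (3 : ℝ) / 2 ^ d.2.2 = 4 * (3 / 4 * (1 / 2 ^ d.2.2)) by ring]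
  exact mul_lt_mul_iff_right₀ (by norm_num)

lemma IsCertificate.names (hf : IsLipschitzOp s f) {c : AlgCode × AlgCode} {w : Certificate}
    (h : IsCertificate s f c w) {α β : ℂ} (hα : c.1.Names α) (hβ : c.2.Names β) :
    w.1.Names (BiList.ev α β s) := by
  obtain ⟨c₁, c₂⟩ := c
  obtain ⟨c₃, ⟨e, U, V⟩, ⟨z₁, z₂⟩, k, m⟩ := w
  obtain ⟨hann, hinj, ⟨hz₁, hm₁⟩, ⟨hz₂, hm₂⟩, hk, hclose⟩ := h
  dsimp only at *
  refine names_of_isInjective hinj (hann.aeval_eq_zero hα.aeval_eq_zero hβ.aeval_eq_zero) ?_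
  rw [normLt_four_mul_iff, hf.val_eq] at hclose
  rw [normLt_iff, norm_val_natCast] at hm₁ hm₂
  have h1 := hf.norm_sub_le m (1 / 2 ^ k) α β z₁.val z₂.val (one_div_two_pow_le_one k)
    (by simpa using hm₁.le) (by simpa using hm₂.le) (hα.norm_sub_lt_of_isApprox hz₁).le
    (hβ.norm_sub_lt_of_isApprox hz₂).le
  -- The precision clause makes the Lipschitz error at most a quarter of the radius; the closeness
  -- clause accounts for the other three quarters.
  have h2 : (2 : ℝ) ^ (m + 2) * (1 / 2 ^ k) ≤ 1 / 2 ^ (c₃.2.2.2 + 2) :=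
    two_pow_mul_one_div_le (by omega)
  have h3 : (1 : ℝ) / 2 ^ (c₃.2.2.2 + 2) = 1 / 4 * (1 / 2 ^ c₃.2.2.2) := by
    rw [pow_add]; ring
  have h4 := norm_sub_le_norm_sub_add_norm_sub (BiList.ev α β s) (BiList.ev z₁.val z₂.val s)
    (val c₃.2)
  linarith

/-- The choices are made in the order `m`, `k₃`, `k`. As the disc around γ shrinks, the derivative
at its centre tends to P'(γ) ≠ 0 while the error term tends to 0, so injectivity holds at some
radius 2^(-k₃). Afterwards `α` and `β` are approximated finely enough for this radius. -/
lemma exists_isCertificate (hf : IsLipschitzOp s f) {c : AlgCode × AlgCode} {α β : ℂ}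
    (hα : c.1.Names α) (hβ : c.2.Names β) : ∃ w, IsCertificate s f c w := by
  obtain ⟨P, e, U, V, hann, hsep⟩ := BiList.exists_annihilates s hα.1 hβ.1
  set γ := BiList.ev α β s with hγdef
  have hγ := hann.aeval_eq_zero hα.aeval_eq_zero hβ.aeval_eq_zero
  have hγ' := hsep γ hγ
  -- The extra 1 makes 2^m bound the approximations of the three numbers too.
  obtain ⟨m, hm⟩ := pow_unbounded_of_one_lt (‖α‖ + ‖β‖ + ‖γ‖ + 1) (one_lt_two (α := ℝ))
  have hα0 := norm_nonneg α
  have hβ0 := norm_nonneg β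
  have hγ0 := norm_nonneg γ
  choose a b hab using exists_close γ
  have hlim : Tendsto (fun k : ℕ => val (a k, b k, k)) atTop (𝓝 γ) := by
    rw [tendsto_iff_norm_sub_tendsto_zero]
    refine squeeze_zero (fun _ => norm_nonneg _) (fun k => ?_) tendsto_one_div_two_pow
    rw [norm_sub_rev]
    have : (0 : ℝ) < 1 / 2 ^ k := by positivity
    linarith [hab k]
  have hder : Tendsto (fun k : ℕ => ‖aeval (val (a k, b k, k)) (derivative (polyOfList P))‖) atTop
      (𝓝 ‖aeval γ (derivative (polyOfList P))‖) :=
    (((Polynomial.continuous_aeval (derivative (polyOfList P))).tendsto γ).comp hlim).norm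
  have hbd : Tendsto (fun k : ℕ => ((growthBound (2 ^ m + 1) P).2.2 : ℝ) * (1 / 2 ^ k)) atTop
      (𝓝 0) := by
    simpa using tendsto_one_div_two_pow.const_mul ((growthBound (2 ^ m + 1) P).2.2 : ℝ)
  obtain ⟨k₃, hk₃⟩ := (hbd.eventually_lt hder (norm_pos_iff.2 hγ')).exists
  -- The margin 8 is 2 for the Lipschitz constant plus 6, so the error is at most 1/64 of the
  -- radius, and 1/64 + 23/32 < 3/4.
  obtain ⟨k, ⟨z₁, hz₁⟩, ⟨z₂, hz₂⟩, hk⟩ := (hα.eventually_exists_isApprox.and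
    (hβ.eventually_exists_isApprox.and (eventually_ge_atTop (m + k₃ + 8)))).exists
  have hd₁ := hα.norm_sub_lt_of_isApprox hz₁
  have hd₂ := hβ.norm_sub_lt_of_isApprox hz₂
  have hk1 := one_div_two_pow_le_one k
  have hn : ∀ (ζ ξ : ℂ), ‖ζ - ξ‖ ≤ 1 → ‖ξ‖ ≤ ‖ζ‖ + 1 := fun ζ ξ h => by
    have := norm_sub_norm_le ξ ζ
    rw [norm_sub_rev] at this
    linarith
  have hm₁ : ‖z₁.val‖ < 2 ^ m := by linarith [hn α z₁.val (by linarith)]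
  have hm₂ : ‖z₂.val‖ < 2 ^ m := by linarith [hn β z₂.val (by linarith)]
  have hm₃ : ‖val (a k₃, b k₃, k₃)‖ < 2 ^ m := by
    linarith [hn γ _ ((hab k₃).trans (by linarith [one_div_two_pow_le_one k₃]))]
  refine ⟨((P, a k₃, b k₃, k₃), (e, U, V), (z₁, z₂), k, m), hann,
    (isInjective_iff _ _).2 ⟨hm₃, hk₃⟩, ⟨hz₁, ?_⟩, ⟨hz₂, ?_⟩, by dsimp only; omega,
    (normLt_four_mul_iff _ _).2 ?_⟩
  · rw [normLt_iff, norm_val_natCast]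
    simpa using hm₁
  · rw [normLt_iff, norm_val_natCast]
    simpa using hm₂
  · dsimp only
    rw [hf.val_eq]
    have h1 := hf.norm_sub_le m (1 / 2 ^ k) α β z₁.val z₂.val hk1 hm₁.le hm₂.le hd₁.le hd₂.le
    have h2 : (2 : ℝ) ^ (m + 2) * (1 / 2 ^ k) ≤ 1 / 2 ^ (k₃ + 6) :=
      two_pow_mul_one_div_le (by omega)
    have h3 : (1 : ℝ) / 2 ^ (k₃ + 6) = 1 / 64 * (1 / 2 ^ k₃) := by
      rw [pow_add]; ring
    have h4 := norm_sub_le_norm_sub_add_norm_sub (BiList.ev z₁.val z₂.val s) γ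
      (val (a k₃, b k₃, k₃))
    rw [norm_sub_rev _ γ] at h4
    have h5 : (0 : ℝ) < 1 / 2 ^ k₃ := by positivity
    linarith [hab k₃]

/-- Codes of `s(α, β)` can be found from codes of `α` and `β` by a partial recursive function. -/
theorem exists_partrec_op (hf : IsLipschitzOp s f) : ∃ F : AlgCode × AlgCode →. AlgCode,
    Partrec F ∧ ∀ (c : AlgCode × AlgCode) (α β : ℂ), c.1.Names α → c.2.Names β →
      (F c).Dom ∧ ∀ d ∈ F c, d.Names (BiList.ev α β s) := by
  obtain ⟨F, hF, hsound, hdom⟩ :=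
    (primrec_isCertificate s hf.primrec).exists_partrec_search
  refine ⟨fun c => (F c).map Prod.fst, hF.map (Computable.fst.comp Computable.snd).to₂,
    fun c α β hα hβ => ⟨hdom c (exists_isCertificate hf hα hβ), fun d hd => ?_⟩⟩
  obtain ⟨w, hw, rfl⟩ := (Part.mem_map_iff _).1 hd
  exact (hsound c w hw).names hf hα hβ

lemma isLipschitzOp_add : IsLipschitzOp [(1, 1, 0), (1, 0, 1)] add where
  primrec := primrec_add
  val_eq z w := by simp
  norm_sub_le m r α β z w _ _ _ hα hβ := by
    simp only [BiList.ev_cons, BiList.ev_nil]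
    have h : (1 : ℝ) ≤ 2 ^ m := one_le_pow₀ (by norm_num)
    have hr : 0 ≤ r := (norm_nonneg _).trans hα
    calc _ = ‖(α - z) + (β - w)‖ := by congr 1; push_cast; ring
      _ ≤ r + r := (norm_add_le _ _).trans (add_le_add hα hβ)
      _ ≤ 2 ^ (m + 2) * r := by rw [pow_add]; nlinarith

lemma isLipschitzOp_mul : IsLipschitzOp [(1, 1, 1)] mul where
  primrec := primrec_mul
  val_eq z w := by simp
  norm_sub_le m r α β z w hr1 hz hw hα hβ := by
    simp only [BiList.ev_cons, BiList.ev_nil]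
    have h : (1 : ℝ) ≤ 2 ^ m := one_le_pow₀ (by norm_num)
    have hr : 0 ≤ r := (norm_nonneg _).trans hα
    calc _ = ‖(α - z) * (β - w) + (α - z) * w + z * (β - w)‖ := by
          congr 1; push_cast; ring
      _ ≤ r * r + r * 2 ^ m + 2 ^ m * r := by
          refine norm_add₃_le.trans (add_le_add_three ?_ ?_ ?_) <;> rw [norm_mul]
          · exact mul_le_mul hα hβ (norm_nonneg _) hr
          · exact mul_le_mul hα hw (norm_nonneg _) hr
          · exact mul_le_mul hz hβ (norm_nonneg _) (by positivity)
      _ ≤ 2 ^ (m + 2) * r := by rw [pow_add]; nlinarith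

end AlgCode

/-! ### Computable families of algebraic numbers -/

/-- A family of complex numbers is computable if codes of its members are. -/
def IsComputableAlg {ι : Type*} [Primcodable ι] (E : ι → ℂ) : Prop :=
  ∃ f : ι → AlgCode, Computable f ∧ ∀ a, (f a).Names (E a)

lemma AlgCode.names_zero : AlgCode.Names ([0, 1], 0, 0, 0) 0 := by
  refine ⟨by simp, fun z => ⟨fun h => by simpa using h.1, ?_⟩⟩
  rintro rfl
  simp

lemma AlgCode.names_one : AlgCode.Names ([-1, 1], 1, 0, 0) 1 := by
  have h0 : polyOfList [-1, 1] = X - 1 := by simp; ring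
  refine ⟨?_, fun z => ⟨fun h => ?_, ?_⟩⟩
  · simp only [h0]
    exact X_sub_C_ne_zero 1
  · have h := h.1
    simp only [h0] at h
    exact sub_eq_zero.1 (by simpa using h)
  · rintro rfl
    simp

/-- Integer coefficients make the root set invariant under conjugation, so only the disc has to be
reflected. -/
lemma AlgCode.Names.star {c : AlgCode} {α : ℂ} (h : c.Names α) :
    AlgCode.Names (c.1, c.2.1, -c.2.2.1, c.2.2.2) (star α) := by
  have hconj : ∀ z : ℂ, aeval (Star.star z) (polyOfList c.1)
      = Star.star (aeval z (polyOfList c.1)) := fun z =>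
    aeval_algHom_apply ((starRingEnd ℂ).toIntAlgHom) z _
  refine ⟨h.1, fun z => ?_⟩
  have hz := h.2 (Star.star z)
  rw [hconj, star_eq_zero, star_eq_iff_star_eq, eq_comm (a := Star.star α)] at hz
  rw [← hz]
  refine and_congr_right fun _ => ?_
  rw [← norm_star (Star.star z - _)]
  simp

namespace IsComputableAlg

variable {ι κ : Type*} [Primcodable ι] [Primcodable κ]

lemma comp {E : ι → ℂ} (hE : IsComputableAlg E) {g : κ → ι} (hg : Computable g) :
    IsComputableAlg fun a => E (g a) := by
  obtain ⟨f, hf, hfE⟩ := hE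
  exact ⟨fun a => f (g a), hf.comp hg, fun a => hfE _⟩

lemma star {E : ι → ℂ} (hE : IsComputableAlg E) : IsComputableAlg fun a => Star.star (E a) := by
  obtain ⟨f, hf, hfE⟩ := hE
  refine ⟨_, Computable.comp (f := fun c : AlgCode => ((c.1, c.2.1, -c.2.2.1, c.2.2.2) : AlgCode))
    (Primrec.to_comp ?_) hf, fun a => (hfE a).star⟩
  have d : Primrec fun c : AlgCode => c.2 := Primrec.snd
  exact Primrec.fst.pair ((Primrec.fst.comp d).pair
    ((Primrec.int_neg.comp (Primrec.fst.comp (Primrec.snd.comp d))).pair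
      (Primrec.snd.comp (Primrec.snd.comp d))))

/-- The search may diverge on codes that name nothing; along a family of genuine codes it always
halts and defines a total computable function. -/
lemma of_partrec {E : ι → ℂ} {F : ι →. AlgCode} (hF : Partrec F)
    (h : ∀ a, (F a).Dom ∧ ∀ d ∈ F a, d.Names (E a)) : IsComputableAlg E :=
  ⟨fun a => (F a).get (h a).1, hF.of_eq_tot fun _ => Part.get_mem _,
    fun a => (h a).2 _ (Part.get_mem _)⟩

lemma mul {E G : ι → ℂ} (hE : IsComputableAlg E) (hG : IsComputableAlg G) :
    IsComputableAlg fun a => E a * G a := by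
  obtain ⟨f, hf, hfE⟩ := hE
  obtain ⟨g, hg, hgG⟩ := hG
  obtain ⟨F, hF, hop⟩ := AlgCode.exists_partrec_op AlgCode.isLipschitzOp_mul
  refine of_partrec (hF.comp (hf.pair hg)) fun a => ?_
  simpa using hop (f a, g a) (E a) (G a) (hfE a) (hgG a)

/-- Halting and correctness go through one induction, because the operation is only known to halt on
codes that name a number. -/
lemma iterate {s : BiList} {f : GDyadic → GDyadic → GDyadic} (hf : AlgCode.IsLipschitzOp s f)
    {c : AlgCode} {E G : ι × ℕ → ℂ} (hE : IsComputableAlg E) (h0 : ∀ a, c.Names (G (a, 0)))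
    (hsucc : ∀ a n, G (a, n + 1) = BiList.ev (G (a, n)) (E (a, n)) s) : IsComputableAlg G := by
  obtain ⟨e, he, heE⟩ := hE
  obtain ⟨F, hF, hop⟩ := AlgCode.exists_partrec_op hf
  have hrec := Partrec.nat_rec (f := fun p : ι × ℕ => p.2) (g := fun _ => Part.some c)
    (h := fun p q => F (q.2, e (p.1, q.1))) Computable.snd (Computable.const c)
    (hF.comp ((Computable.snd.comp Computable.snd).pair
      (he.comp ((Computable.fst.comp Computable.fst).pair
        (Computable.fst.comp Computable.snd)))))
  refine of_partrec hrec fun p => ?_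
  obtain ⟨a, n⟩ := p
  induction n with
  | zero => exact ⟨trivial, fun d hd => by rw [Part.mem_some_iff.1 hd]; exact h0 a⟩
  | succ n ih =>
    obtain ⟨hd, hn⟩ := ih
    have key := fun d hd => hop (d, e (a, n)) _ _ (hn d hd) (heE (a, n))
    refine ⟨Part.bind_dom.2 ⟨hd, (key _ (Part.get_mem hd)).1⟩, fun d hd => ?_⟩
    obtain ⟨d', hd', hdF⟩ := Part.mem_bind_iff.1 hd
    rw [hsucc]
    exact (key d' hd').2 d hdF

lemma sum_range {E : ι × ℕ → ℂ} (hE : IsComputableAlg E) :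
    IsComputableAlg fun p : ι × ℕ => ∑ i ∈ Finset.range p.2, E (p.1, i) :=
  iterate AlgCode.isLipschitzOp_add hE (fun a => by simpa using AlgCode.names_zero)
    fun a n => by simp [Finset.sum_range_succ]

lemma prod_range {E : ι × ℕ → ℂ} (hE : IsComputableAlg E) :
    IsComputableAlg fun p : ι × ℕ => ∏ i ∈ Finset.range p.2, E (p.1, i) :=
  iterate AlgCode.isLipschitzOp_mul hE (fun a => by simpa using AlgCode.names_one)
    fun a n => by simp [Finset.prod_range_succ]

end IsComputableAlg

/-! ### Projections onto spans of product vectors -/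

/-- The projection onto the span of the product vectors of the strings in `C`. -/
def projSet (B : MeasurementSystem) {n : ℕ} (C : Finset (BitStr n)) : QubitMatrix n :=
  ∑ τ ∈ C, vecMulVec (productVec B τ) (star (productVec B τ))

lemma projSet_apply (B : MeasurementSystem) {n : ℕ} (C : Finset (BitStr n)) (x y : BitStr n) :
    projSet B C x y = ∑ τ ∈ C, productVec B τ x * star (productVec B τ y) := by
  simp [projSet, Matrix.sum_apply, vecMulVec_apply]

lemma sum_star_mul_basis (b : OrthonormalBasis Bool ℂ (EuclideanSpace ℂ Bool)) (i j : Bool) :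
    ∑ c, star (b i c) * b j c = if i = j then 1 else 0 := by
  have h := orthonormal_iff_ite.1 b.orthonormal i j
  rw [PiLp.inner_apply] at h
  rw [← h]
  exact Finset.sum_congr rfl fun c _ => by simp [mul_comm]

/-- The sum over all strings of a product over qubits is the product of the sums over single bits,
each of which is an inner product in an orthonormal basis of ℂ². -/
lemma star_productVec_dotProduct (B : MeasurementSystem) {n : ℕ} (σ τ : BitStr n) :
    star (productVec B σ) ⬝ᵥ productVec B τ = if σ = τ then 1 else 0 := by
  have h : ∀ x : BitStr n, star (productVec B σ) x * productVec B τ x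
      = ∏ i : Fin n, star (B i (σ i) (x i)) * B i (τ i) (x i) := by
    intro x
    rw [Pi.star_apply, productVec, productVec, star_prod, Finset.prod_mul_distrib]
  rw [dotProduct]
  simp_rw [h]
  rw [← Fintype.piFinset_univ, ← Finset.prod_univ_sum (fun _ => Finset.univ)
    (fun (i : Fin n) c => star (B i (σ i) c) * B i (τ i) c)]
  simp_rw [sum_star_mul_basis]
  rw [Finset.prod_ite_zero]
  simp [funext_iff]

/-- Orthonormality makes these projections multiply like indicator functions. Equal sets give
idempotence, and nested sets give inclusion of ranges. -/
lemma projSet_mul (B : MeasurementSystem) {n : ℕ} (C D : Finset (BitStr n)) :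
    projSet B C * projSet B D = projSet B (C ∩ D) := by
  rw [projSet, projSet, Finset.sum_mul]
  simp_rw [Finset.mul_sum, vecMulVec_mul_vecMulVec, star_productVec_dotProduct]
  rw [projSet, ← Finset.filter_mem_eq_inter, Finset.sum_filter]
  refine Finset.sum_congr rfl fun σ _ => ?_
  have : ∀ τ, vecMulVec (productVec B σ)
      ((if σ = τ then (1 : ℂ) else 0) • star (productVec B τ))
      = if σ = τ then vecMulVec (productVec B σ) (star (productVec B σ)) else 0 := by
    intro τ
    split_ifs with h
    · rw [one_smul, h]
    · simp
  simp_rw [this]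
  simp

lemma isHermitian_projSet (B : MeasurementSystem) {n : ℕ} (C : Finset (BitStr n)) :
    (projSet B C).IsHermitian := by
  ext x y
  rw [conjTranspose_apply, projSet_apply, projSet_apply, star_sum]
  exact Finset.sum_congr rfl fun τ _ => by rw [star_mul', star_star, mul_comm]

/-- With the product vectors as columns of `V`, the projection is V Vᴴ and Vᴴ V is the identity of
size `C.card`; both have the rank of `V`. -/
lemma rank_projSet (B : MeasurementSystem) {n : ℕ} (C : Finset (BitStr n)) :
    (projSet B C).rank = C.card := by
  let V : Matrix (BitStr n) C ℂ := Matrix.of fun x τ => productVec B (τ : BitStr n) x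
  have h1 : projSet B C = V * Vᴴ := by
    ext x y
    rw [projSet_apply, mul_apply, ← Finset.sum_coe_sort]
    rfl
  have h2 : Vᴴ * V = 1 := by
    ext σ τ
    rw [mul_apply, one_apply]
    have := star_productVec_dotProduct B (σ : BitStr n) (τ : BitStr n)
    simp only [Subtype.coe_inj] at this
    exact this
  rw [h1, rank_self_mul_conjTranspose, ← rank_conjTranspose_mul_self, h2, rank_one,
    Fintype.card_coe]

/-- The identity on the new qubit is the sum of the two projections onto the vectors of its basis.
-/
lemma tensorOne_projSet (B : MeasurementSystem) {n : ℕ} (C : Finset (BitStr n)) :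
    tensorOne (projSet B C)
      = projSet B ((C ×ˢ Finset.univ).image fun p : BitStr n × Bool => snocBit p.1 p.2) := by
  have hinj : Function.Injective fun p : BitStr n × Bool => snocBit p.1 p.2 := by
    rintro ⟨τ, b⟩ ⟨τ', b'⟩ h
    have := Fin.snoc_inj.1 h
    exact Prod.ext this.1 this.2
  ext x y
  obtain ⟨⟨x, c⟩, rfl⟩ : ∃ p : BitStr n × Bool, snocBit p.1 p.2 = x :=
    ⟨(fun i => x i.castSucc, x (Fin.last n)), Fin.snoc_init_self x⟩
  obtain ⟨⟨y, d⟩, rfl⟩ : ∃ p : BitStr n × Bool, snocBit p.1 p.2 = y :=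
    ⟨(fun i => y i.castSucc, y (Fin.last n)), Fin.snoc_init_self y⟩
  rw [projSet_apply, Finset.sum_image hinj.injOn, Finset.sum_product]
  simp_rw [productVec_snoc, star_mul']
  have : ∀ τ : BitStr n, ∑ b, productVec B τ x * B n b c
      * (star (productVec B τ y) * star (B n b d))
      = productVec B τ x * star (productVec B τ y) * if c = d then 1 else 0 := by
    intro τ
    rw [← sum_basis_mul_star (B n) c d, Finset.mul_sum]
    exact Finset.sum_congr rfl fun b _ => by ring
  simp_rw [this]
  rw [← Finset.sum_mul, ← projSet_apply]
  simp [tensorOne, snocBit, one_apply]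

lemma range_mulVecLin_le_of_mul_eq {n : ℕ} {p q : QubitMatrix n} (h : q * p = p) :
    LinearMap.range p.mulVecLin ≤ LinearMap.range q.mulVecLin := by
  rw [← h, mulVecLin_mul]
  exact LinearMap.range_comp_le_range _ _

lemma range_tensorOne_projSet_le (B : MeasurementSystem) {n : ℕ} {C : Finset (BitStr n)}
    {D : Finset (BitStr (n + 1))} (h : cylSet C ⊆ cylSet D) :
    LinearMap.range (tensorOne (projSet B C)).mulVecLin
      ≤ LinearMap.range (projSet B D).mulVecLin := by
  refine range_mulVecLin_le_of_mul_eq ?_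
  rw [tensorOne_projSet, projSet_mul, Finset.inter_eq_right.2]
  intro x hx
  obtain ⟨⟨τ, b⟩, hτ, rfl⟩ := Finset.mem_image.1 hx
  have hτ : τ ∈ C := (Finset.mem_product.1 hτ).1
  have hE : ∀ {k : ℕ} (σ : BitStr k), (fun i : Fin k => extendZero σ i) = σ := fun σ => by
    funext i; simp [extendZero]
  -- The inclusion of cylinder sets concerns infinite sequences; the extension by zeros is a
  -- sequence on which it can be tested.
  have h1 : extendZero (snocBit τ b) ∈ cylSet C := by
    change (fun i : Fin n => extendZero (snocBit τ b) i) ∈ C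
    have : (fun i : Fin n => extendZero (snocBit τ b) i) = τ := by
      funext i
      have h1 : (i : ℕ) < n + 1 := by omega
      simp [extendZero, h1, snocBit, Fin.snoc]
    rwa [this]
  have h2 := h h1
  change (fun i : Fin (n + 1) => extendZero (snocBit τ b) i) ∈ D at h2
  rwa [hE] at h2

lemma trace_mul_projSet (ρ : QState) (B : MeasurementSystem) {n : ℕ} (C : Finset (BitStr n)) :
    (ρ.mat n * projSet B C).trace.re = ∑ τ ∈ C, outcomeProb ρ B τ := by
  rw [projSet, Finset.mul_sum, trace_sum, Complex.re_sum]
  rfl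

/-! ### Measures of clopen sets -/

lemma cylSet_eq_iUnion {n : ℕ} (C : Finset (BitStr n)) : cylSet C = ⋃ τ ∈ C, cyl τ := by
  ext X
  simp only [cylSet, cyl, Set.mem_iUnion, exists_prop]
  constructor
  · intro h
    exact ⟨_, h, fun i => rfl⟩
  · rintro ⟨τ, hτ, h⟩
    have : (fun i : Fin n => X i) = τ := funext h
    change (fun i : Fin n => X i) ∈ C
    rwa [this]

lemma measure_cylSet (ν : Measure Cantor) {n : ℕ} (C : Finset (BitStr n)) :
    ν (cylSet C) = ∑ τ ∈ C, ν (cyl τ) := by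
  rw [cylSet_eq_iUnion]
  refine measure_biUnion_finset (fun τ _ τ' _ hne => ?_) fun τ _ => measurableSet_cyl τ
  rw [Function.onFun, Set.disjoint_left]
  exact fun X h h' => hne (funext fun i => (h i).symm.trans (h' i))

lemma uniformMeasure_cyl {n : ℕ} (τ : BitStr n) : uniformMeasure (cyl τ) = (2 : ENNReal)⁻¹ ^ n := by
  have h : cyl τ = Set.pi (Finset.range n) fun i => {extendZero τ i} := by
    ext X
    simp only [cyl, Set.mem_pi, Finset.coe_range, Set.mem_Iio, Set.mem_singleton_iff]
    constructor
    · intro h i hi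
      simpa [extendZero, hi] using h ⟨i, hi⟩
    · intro h i
      simpa [extendZero] using h i i.2
  rw [h, uniformMeasure, Measure.infinitePi_pi _ fun i _ => measurableSet_singleton _]
  simp

instance : IsProbabilityMeasure uniformMeasure := by
  unfold uniformMeasure; infer_instance

lemma uniformMeasure_cylSet_toReal {n : ℕ} (C : Finset (BitStr n)) :
    (uniformMeasure (cylSet C)).toReal = (C.card : ℝ) / 2 ^ n := by
  rw [measure_cylSet]
  simp_rw [uniformMeasure_cyl]
  simp [div_eq_mul_inv]

lemma measurementMeasure_cylSet_toReal (ρ : QState) (B : MeasurementSystem) {n : ℕ}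
    (C : Finset (BitStr n)) : (measurementMeasure ρ B (cylSet C)).toReal
      = (ρ.mat n * projSet B C).trace.re := by
  rw [measure_cylSet, trace_mul_projSet, ENNReal.toReal_sum fun τ _ => measure_ne_top _ _]
  refine Finset.sum_congr rfl fun τ _ => ?_
  rw [measurementMeasure_cyl, ENNReal.toReal_ofReal (outcomeProb_nonneg ρ B τ)]

/-- Continuity from below. It identifies the limits defining `qTau` and `QState.eval` when applied
to the uniform and to the measurement measure. -/
lemma tendsto_measure_cylSet (ν : Measure Cantor) [IsProbabilityMeasure ν]
    {A : ∀ i : ℕ, Finset (BitStr i)} (hA : ∀ i, cylSet (A i) ⊆ cylSet (A (i + 1))) :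
    Tendsto (fun i => (ν (cylSet (A i))).toReal) atTop (𝓝 (ν (⋃ i, cylSet (A i))).toReal) :=
  (ENNReal.tendsto_toReal (measure_ne_top _ _)).comp
    (tendsto_measure_iUnion_atTop (monotone_nat_of_le_succ hA))

/-! ### Computability of the projections -/

/-- The code of a finite set of strings, with repetitions removed. -/
def removeRepetitions (l : List (List Bool)) : List (List Bool) :=
  l.foldr (fun s m => if s ∈ m then m else s :: m) []

lemma mem_removeRepetitions {l : List (List Bool)} {s : List Bool} :
    s ∈ removeRepetitions l ↔ s ∈ l := by
  induction l with
  | nil => simp [removeRepetitions]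
  | cons a l ih =>
    have h : removeRepetitions (a :: l) = if a ∈ removeRepetitions l then removeRepetitions l
      else a :: removeRepetitions l := rfl
    rw [h, List.mem_cons, ← ih]
    split_ifs with ha
    · exact ⟨Or.inr, fun h => h.elim (fun h => h ▸ ha) id⟩
    · exact List.mem_cons

lemma nodup_removeRepetitions (l : List (List Bool)) : (removeRepetitions l).Nodup := by
  induction l with
  | nil => simp [removeRepetitions]
  | cons a l ih =>
    have h : removeRepetitions (a :: l) = if a ∈ removeRepetitions l then removeRepetitions l
      else a :: removeRepetitions l := rfl
    rw [h]
    split_ifs with ha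
    · exact ih
    · exact List.nodup_cons.2 ⟨ha, ih⟩

lemma primrec_removeRepetitions : Primrec removeRepetitions := by
  have hmem : PrimrecRel fun (m : List (List Bool)) (s : List Bool) => s ∈ m :=
    (PrimrecRel.exists_mem_list (R := fun a s : List Bool => a = s) Primrec.eq).of_eq
      fun m s => by simp
  refine Primrec.list_foldr (f := fun l : List (List Bool) => l)
    (h := fun _ (q : List Bool × List (List Bool)) => if q.1 ∈ q.2 then q.2 else q.1 :: q.2)
    Primrec.id (Primrec.const []) ?_
  exact Primrec.ite (hmem.comp (Primrec.snd.comp Primrec.snd) (Primrec.fst.comp Primrec.snd))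
    (Primrec.snd.comp Primrec.snd)
    (Primrec.list_cons.comp (Primrec.fst.comp Primrec.snd) (Primrec.snd.comp Primrec.snd))

lemma sum_range_getD {α M : Type*} [AddCommMonoid M] (l : List α) (d : α) (g : α → M) :
    ∑ j ∈ Finset.range l.length, g (l.getD j d) = (l.map g).sum := by
  induction l with
  | nil => simp
  | cons a l ih =>
    rw [List.length_cons, Finset.sum_range_succ', List.map_cons, List.sum_cons, ← ih]
    simp [add_comm]

/-- `CodesSet` permits repetitions in the list, and a string listed twice would otherwise contribute
twice to an entry of the projection. -/
lemma sum_removeRepetitions {M : Type*} [AddCommMonoid M] {l : List (List Bool)} {n : ℕ}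
    {C : Finset (BitStr n)} (h : CodesSet l C) (g : List Bool → M) :
    ((removeRepetitions l).map g).sum = ∑ τ ∈ C, g (List.ofFn τ) := by
  rw [← List.sum_toFinset g (nodup_removeRepetitions l)]
  have : (removeRepetitions l).toFinset = C.image List.ofFn := by
    ext s
    rw [List.mem_toFinset, mem_removeRepetitions, h s, Finset.mem_image]
  rw [this, Finset.sum_image List.ofFn_injective.injOn]

/-- The entries of the projections, as functions of the strings. -/
lemma isComputableAlg_entry {B : MeasurementSystem} (hB : IsComputableSystem B) :
    IsComputableAlg fun p : (List Bool × List Bool × List Bool) × ℕ =>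
      ∏ i ∈ Finset.range p.2, B i (p.1.1.getD i false) (p.1.2.1.getD i false)
        * star (B i (p.1.1.getD i false) (p.1.2.2.getD i false)) := by
  have hB' : IsComputableAlg fun p : ℕ × Bool × Bool => B p.1 p.2.1 p.2.2 := by
    obtain ⟨f, hf, h⟩ := hB
    exact ⟨f, hf, fun p => h _ _ _⟩
  have s : Primrec fun p : (List Bool × List Bool × List Bool) × ℕ => p.1.1.getD p.2 false :=
    (Primrec.list_getD false).comp (Primrec.fst.comp Primrec.fst) Primrec.snd
  have x : Primrec fun p : (List Bool × List Bool × List Bool) × ℕ => p.1.2.1.getD p.2 false :=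
    (Primrec.list_getD false).comp (Primrec.fst.comp (Primrec.snd.comp Primrec.fst)) Primrec.snd
  have y : Primrec fun p : (List Bool × List Bool × List Bool) × ℕ => p.1.2.2.getD p.2 false :=
    (Primrec.list_getD false).comp (Primrec.snd.comp (Primrec.snd.comp Primrec.fst)) Primrec.snd
  exact ((hB'.comp (Primrec.snd.pair (s.pair x)).to_comp).mul
    (hB'.comp (Primrec.snd.pair (s.pair y)).to_comp).star).prod_range

lemma computableMatrices_projSet {B : MeasurementSystem} (hB : IsComputableSystem B)
    {A : ∀ _ i : ℕ, Finset (BitStr i)} {L : ℕ → ℕ → List (List Bool)} (hL : Computable₂ L)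
    (hLA : ∀ m i, CodesSet (L m i) (A m i)) :
    ComputableMatrices (fun a : ℕ × ℕ => a.2) (fun a => projSet B (A a.1 a.2)) := by
  let l : (ℕ × ℕ) × List Bool × List Bool → List (List Bool) := fun p =>
    removeRepetitions (L p.1.1 p.1.2)
  have hl : Computable l := primrec_removeRepetitions.to_comp.comp
    (hL.comp (Computable.fst.comp Computable.fst) (Computable.snd.comp Computable.fst))
  have hj : Computable fun p : ((ℕ × ℕ) × List Bool × List Bool) × ℕ => (l p.1).getD p.2 [] :=
    (Primrec.list_getD []).to_comp.comp (hl.comp Computable.fst) Computable.snd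
  have h1 := ((isComputableAlg_entry hB).comp (hj.pair (Computable.snd.comp Computable.fst)
    |>.pair (Computable.snd.comp (Computable.fst.comp Computable.fst)))).sum_range
  obtain ⟨f, hf, h⟩ := h1.comp (Computable.id.pair (Computable.list_length.comp hl))
  refine ⟨f, hf, fun a x y => ?_⟩
  have h2 := h (a, List.ofFn x, List.ofFn y)
  simp only [id] at h2
  -- The default values `[]` and `false` only make the functions total: all indices in these sums
  -- and products lie below the lengths of the lists.
  rw [sum_range_getD (l (a, List.ofFn x, List.ofFn y)) [] fun s => ∏ i ∈ Finset.range a.2,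
    B i (s.getD i false) ((List.ofFn x).getD i false)
      * star (B i (s.getD i false) ((List.ofFn y).getD i false)),
    sum_removeRepetitions (hLA a.1 a.2)] at h2
  change (f (a, List.ofFn x, List.ofFn y)).Names (projSet B (A a.1 a.2) x y)
  rw [projSet_apply]
  convert h2 using 1
  refine Finset.sum_congr rfl fun τ _ => ?_
  rw [productVec, productVec, star_prod, ← Finset.prod_mul_distrib, Finset.prod_range]
  refine Finset.prod_congr rfl fun i _ => ?_
  simp [List.getD_eq_getElem?_getD]

lemma AlgCode.Names.isAlgebraic {c : AlgCode} {α : ℂ} (h : c.Names α) : IsAlgebraic ℚ α := by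
  refine ⟨(polyOfList c.1).map (algebraMap ℤ ℚ),
    (Polynomial.map_ne_zero_iff (algebraMap ℤ ℚ).injective_int).2 h.1, ?_⟩
  rw [aeval_map_algebraMap]
  exact h.aeval_eq_zero

/-! ### Quantum tests from classical tests -/

/-- Measuring in `B` turns a Martin-Löf test into a quantum Martin-Löf test. -/
theorem IsMLTest.exists_isQMLTest {S : ℕ → Set Cantor} (hS : IsMLTest S) {B : MeasurementSystem}
    (hB : IsComputableSystem B) : ∃ G : ℕ → ∀ n, QubitMatrix n, IsQMLTest G ∧
      ∀ (ρ : QState) (m : ℕ), ρ.eval (G m) = (measurementMeasure ρ B (S m)).toReal := by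
  obtain ⟨⟨A, ⟨L, hL, hLA⟩, hmono, hSA⟩, hmeas⟩ := hS
  have hcomp := computableMatrices_projSet hB hL hLA
  refine ⟨fun m n => projSet B (A m n), ⟨fun m => ⟨?_, fun n => ?_, fun n => ?_⟩, hcomp,
    fun m => ?_⟩, fun ρ m => ?_⟩
  · obtain ⟨f, hf, h⟩ := hcomp
    exact ⟨fun p => f ((m, p.1), p.2), hf.comp (((Computable.const m).pair Computable.fst).pair
      Computable.snd), fun n x y => h (m, n) x y⟩
  · refine ⟨isHermitian_projSet B _, by rw [projSet_mul, Finset.inter_self], fun x y => ?_⟩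
    obtain ⟨f, hf, h⟩ := hcomp
    exact (h (m, n) x y).isAlgebraic
  · exact range_tensorOne_projSet_le B (hmono m n)
  · have h1 := tendsto_measure_cylSet uniformMeasure (hmono m)
    -- The normalised rank is exactly the uniform measure of the clopen set, so the bound for the
    -- classical test carries over unchanged.
    simp_rw [uniformMeasure_cylSet_toReal, ← rank_projSet B] at h1
    rw [qTau, h1.limUnder_eq, ← hSA]
    have := ENNReal.toReal_mono (by simp) (hmeas m)
    simpa using this
  · have h1 := tendsto_measure_cylSet (measurementMeasure ρ B) (hmono m)
    simp_rw [measurementMeasure_cylSet_toReal] at h1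
    rw [QState.eval, h1.limUnder_eq, ← hSA]

lemma countable_computable_lists : Countable {L : ℕ × ℕ → List (List Bool) // Computable L} := by
  let e : {L : ℕ × ℕ → List (List Bool) // Computable L} → {f : ℕ → ℕ // Computable f} :=
    fun L => ⟨fun n => Encodable.encode (L.1 n.unpair),
      Computable.encode.comp (L.2.comp Computable.unpair)⟩
  refine Function.Injective.countable (f := e) fun L L' h => Subtype.ext (funext fun p => ?_)
  have h1 := congrFun (congrArg Subtype.val h) (Nat.pair p.1 p.2)
  simpa [e] using h1

/-- There are only countably many Martin-Löf tests. -/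
lemma countable_isMLTest : {S : ℕ → Set Cantor | IsMLTest S}.Countable := by
  have := countable_computable_lists
  -- The classes of a test are determined by the computable function that codes them, so tests lie
  -- in the image of a countable set.
  let T : {L : ℕ × ℕ → List (List Bool) // Computable L} → ℕ → Set Cantor := fun L m =>
    {X | ∃ i : ℕ, List.ofFn (fun j : Fin i => X j) ∈ L.1 (m, i)}
  refine (Set.countable_range T).mono ?_
  rintro S ⟨⟨A, ⟨L, hL, hLA⟩, -, hSA⟩, -⟩
  refine ⟨⟨fun p => L p.1 p.2, hL⟩, funext fun m => ?_⟩
  rw [hSA]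
  ext X
  simp only [T, Set.mem_iUnion]
  refine exists_congr fun i => (hLA m i _).trans ⟨?_, fun h => ⟨_, h, rfl⟩⟩
  rintro ⟨τ, hτ, h⟩
  rw [List.ofFn_injective h] at hτ
  exact hτ

/-- The intersection of a Martin-Löf test is null for the outcome of measuring a quantum Martin-Löf
random state. -/
lemma QState.IsQMLR.measure_iInter_eq_zero {ρ : QState} (hρ : ρ.IsQMLR) {B : MeasurementSystem}
    (hB : IsComputableSystem B) {S : ℕ → Set Cantor} (hS : IsMLTest S) :
    measurementMeasure ρ B (⋂ m, S m) = 0 := by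
  obtain ⟨G, hG, heval⟩ := hS.exists_isQMLTest hB
  have h0 := hρ G hG
  have hle : (measurementMeasure ρ B (⋂ m, S m)).toReal ≤ ⨅ m, ρ.eval (G m) := by
    refine le_ciInf fun m => ?_
    rw [heval]
    exact ENNReal.toReal_mono (measure_ne_top _ _) (measure_mono (Set.iInter_subset S m))
  rw [h0] at hle
  have := le_antisymm hle ENNReal.toReal_nonneg
  exact ((ENNReal.toReal_eq_zero_iff _).1 this).resolve_right (measure_ne_top _ _)

end

theorem theorem3p2 (ρ : QState) (hρ : ρ.IsQMLR) : ρ.IsMeasurementRandom := by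
  intro B hB
  have hnull : measurementMeasure ρ B MLRᶜ = 0 := by
    have hU : MLRᶜ = ⋃ S ∈ {S : ℕ → Set Cantor | IsMLTest S}, ⋂ m, S m := by
      ext X
      simp [MLR]
    rw [hU, MeasureTheory.measure_biUnion_null_iff countable_isMLTest]
    exact fun S hS => hρ.measure_iInter_eq_zero hB hS
  have hae : MLR =ᵐ[measurementMeasure ρ B] Set.univ := Filter.eventuallyEq_univ.2 hnull
  rw [MeasureTheory.measure_congr hae, MeasureTheory.measure_univ]
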